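/- Let $d_A\in\{1,2,3\}$ and $d_B\ge 1$, let $R_1,R_2,R_3$ be complex $d_A\times d_A$ matrices and $S_1,S_2,S_3$ complex $d_B\times d_B$ matrices (no linear independence is assumed), and suppose that $U=\sum_{i=1}^3 R_i\otimes S_i$ is a unitary matrix on $\mathbb{C}^{d_A}\otimes\mathbb{C}^{d_B}$. Let $U^{\Gamma}=\sum_{i=1}^3 R_i\otimes S_i^{T}$ be its partial transpose on the second factor. Then: (1) $U$ is locally equivalent to a controlled unitary: there are unitary $d_A\times d_A$ matrices $Q,R$ and unitary $d_B\times d_B$ matrices $Q',R'$ such that $U=(Q\otimes Q')\,W\,(R\otimes R')$, where either $W=\sum_{k=1}^{d_A}|k\rangle\langle k|\otimes V_k$ with unitary $d_B\times d_B$ matrices $V_k$, or $W=\sum_{k=1}^{d_B}V_k\otimes|k\rangle\langle k|$ with unitary $d_A\times d_A$ matrices $V_k$; (2) $\operatorname{rank} U^{\Gamma}=\operatorname{rank} U$; (3) in particular, $\operatorname{rank}\left(\sum_{i=1}^3 R_i\otimes S_i^{T}\right)\le 3\cdot\operatorname{rank}\left(\sum_{i=1}^3 R_i\otimes S_i\right)$.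 -/

import Mathlib

open scoped Kronecker

/-- `U` and `V` are locally equivalent: `U = (Q ⊗ Q') V (R ⊗ R')` with `Q, R` unitary on the first
system and `Q', R'` unitary on the second. -/
def LocallyEquivalent {dA dB : ℕ} (U V : Matrix (Fin dA × Fin dB) (Fin dA × Fin dB) ℂ) : Prop :=
  ∃ Q ∈ Matrix.unitaryGroup (Fin dA) ℂ, ∃ Q' ∈ Matrix.unitaryGroup (Fin dB) ℂ,
  ∃ R ∈ Matrix.unitaryGroup (Fin dA) ℂ, ∃ R' ∈ Matrix.unitaryGroup (Fin dB) ℂ,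
    U = (Q ⊗ₖ Q') * V * (R ⊗ₖ R')

/-- `U` is locally equivalent to `∑ k, |k⟩⟨k| ⊗ V k` with all `V k` unitary. -/
def IsControlledFromA {dA dB : ℕ} (U : Matrix (Fin dA × Fin dB) (Fin dA × Fin dB) ℂ) : Prop :=
  ∃ V : Fin dA → Matrix (Fin dB) (Fin dB) ℂ,
    (∀ k, V k ∈ Matrix.unitaryGroup (Fin dB) ℂ) ∧
    LocallyEquivalent U (∑ k, Matrix.single k k (1 : ℂ) ⊗ₖ V k)

/-- `U` is locally equivalent to `∑ k, V k ⊗ |k⟩⟨k|` with all `V k` unitary. -/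
def IsControlledFromB {dA dB : ℕ} (U : Matrix (Fin dA × Fin dB) (Fin dA × Fin dB) ℂ) : Prop :=
  ∃ V : Fin dB → Matrix (Fin dA) (Fin dA) ℂ,
    (∀ k, V k ∈ Matrix.unitaryGroup (Fin dA) ℂ) ∧
    LocallyEquivalent U (∑ k, V k ⊗ₖ Matrix.single k k (1 : ℂ))

/-- `U` is locally equivalent to a controlled unitary, controlled from either side. -/
def IsControlledUnitary {dA dB : ℕ} (U : Matrix (Fin dA × Fin dB) (Fin dA × Fin dB) ℂ) : Prop :=
  IsControlledFromA U ∨ IsControlledFromB U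

/-! A unitary with three product terms has, in suitable local bases, all its blocks diagonal on one
of the two factors (`hasDiagonalBlocks_or_hasDiagonalBlocks`); this is the controlled form. The
partial transpose of a controlled unitary is again unitary, so both ranks in the theorem are full.

Diagonality is proved by induction on the sum of the two dimensions. Moving a multiple of one term
into another makes `R 0` singular; let `y`, `x` be unit vectors killed by `R 0` and `(R 0)ᴴ`.
Compressing `UᴴU = 1` to `y` and `UUᴴ = 1` to `x` leaves relations between `S 1` and `S 2` alone,
weighted by Gram matrices. If one of these degenerates, the kernel vector is sent into a single line
and splits off (or fills its factor). Otherwise a simultaneous congruence and a trace argument yield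
combinations `P`, `Q` of `S 1`, `S 2` with `PᴴP + QᴴQ = 1 = PPᴴ + QQᴴ`, and such a pair is
simultaneously diagonal in two orthonormal bases. If `R 0 = 0` this is all that is needed; if not,
the off-diagonal blocks are multiples of `R 0`, and unitarity forces diagonality or a split of one
factor (`isBlockSplit_of_diagonal`).

A split leaves two smaller unitaries sharing the operators on the other factor. If both are diagonal
on the split factor, they are glued. If one is not, induction makes it diagonal on the shared factor
and its own three operators must be independent, so each shared operator is diagonal and `U` with
them (`IsBlockSplit.hasDiagonalBlocks`). -/

open scoped ComplexOrder
open Matrix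

/-! ### Singular values, joint diagonalization and congruence. -/

section LinearAlgebra

variable {n : Type*} [Fintype n] [DecidableEq n]

/-- The matrix whose columns are the vectors of an orthonormal basis is unitary. -/
lemma OrthonormalBasis.of_mem_unitaryGroup (e : OrthonormalBasis n ℂ (EuclideanSpace ℂ n)) :
    (Matrix.of fun i j => e j i) ∈ Matrix.unitaryGroup n ℂ :=
  (EuclideanSpace.basisFun n ℂ).toMatrix_orthonormalBasis_mem_unitary e

/-- If `M` maps the `j`-th vector of one orthonormal basis to a multiple of the `j`-th vector of
another, then `M` is diagonal with respect to these bases. -/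
lemma conjTranspose_mul_mul_eq_diagonal (e f : OrthonormalBasis n ℂ (EuclideanSpace ℂ n))
    (M : Matrix n n ℂ) (t : n → ℂ) (h : ∀ j, M *ᵥ (e j) = t j • (f j : n → ℂ)) :
    (Matrix.of fun i j => f j i)ᴴ * M * (Matrix.of fun i j => e j i) = Matrix.diagonal t := by
  have h1 : M * (Matrix.of fun i j => e j i) =
      (Matrix.of fun i j => f j i) * Matrix.diagonal t := by
    ext i j
    have := congrFun (h j) i
    simp only [Matrix.mul_diagonal, Matrix.of_apply]
    rw [Matrix.mul_apply]
    simp only [Matrix.mulVec, dotProduct, Pi.smul_apply, smul_eq_mul] at this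
    simpa [mul_comm] using this
  have h2 := Matrix.mem_unitaryGroup_iff'.mp f.of_mem_unitaryGroup
  rw [Matrix.star_eq_conjTranspose] at h2
  rw [mul_assoc, h1, ← mul_assoc, h2, one_mul]

/-- Singular value decomposition of a square complex matrix. -/
lemma exists_unitary_mul_mul_eq_diagonal (M : Matrix n n ℂ) :
    ∃ Q ∈ Matrix.unitaryGroup n ℂ, ∃ R ∈ Matrix.unitaryGroup n ℂ, ∃ t : n → ℝ,
      (∀ i, 0 ≤ t i) ∧ Q * M * R = Matrix.diagonal fun i => (t i : ℂ) := by
  have hH : (Mᴴ * M).PosSemidef := Matrix.posSemidef_conjTranspose_mul_self M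
  set e := hH.isHermitian.eigenvectorBasis with he
  set l := hH.isHermitian.eigenvalues with hl
  have hl0 : ∀ i, 0 ≤ l i := hH.eigenvalues_nonneg
  have hMe : ∀ j, (Mᴴ * M) *ᵥ (e j) = (l j) • (e j : n → ℂ) :=
    hH.isHermitian.mulVec_eigenvectorBasis
  have hin : ∀ i j, inner ℂ (WithLp.toLp 2 (M *ᵥ (e i)) : EuclideanSpace ℂ n)
      (WithLp.toLp 2 (M *ᵥ (e j))) = if i = j then (l i : ℂ) else 0 := by
    intro i j
    rw [EuclideanSpace.inner_eq_star_dotProduct]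
    have h1 : (M *ᵥ (e j)) ⬝ᵥ star (M *ᵥ (e i)) = ((Mᴴ * M) *ᵥ (e j)) ⬝ᵥ star (e i : n → ℂ) := by
      rw [dotProduct_comm, dotProduct_comm _ (star _), ← Matrix.mulVec_mulVec,
        Matrix.dotProduct_mulVec (star _) Mᴴ, ← Matrix.star_mulVec]
    change (M *ᵥ (e j)) ⬝ᵥ star (M *ᵥ (e i)) = _
    rw [h1, hMe]
    have h2 := orthonormal_iff_ite.mp e.orthonormal i j
    rw [EuclideanSpace.inner_eq_star_dotProduct] at h2
    rw [smul_dotProduct, h2]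
    split_ifs with hij
    · subst hij; simp
    · simp
  -- Left singular vectors. Where `l i = 0` the value is the junk `0`; only the others are kept, and
  -- extended to an orthonormal basis.
  let w : n → EuclideanSpace ℂ n := fun i =>
    ((Real.sqrt (l i) : ℂ)⁻¹) • WithLp.toLp 2 (M *ᵥ (e i))
  have hw : Orthonormal ℂ (({i | l i ≠ 0} : Set n).domRestrict w) := by
    rw [orthonormal_iff_ite]
    rintro ⟨i, hi⟩ ⟨j, hj⟩
    simp only [Set.domRestrict_apply, w, inner_smul_left, inner_smul_right, hin, Subtype.mk.injEq]
    split_ifs with hij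
    · subst hij
      have hs : (Real.sqrt (l i) : ℂ) * (Real.sqrt (l i) : ℂ) = l i := by
        rw [← Complex.ofReal_mul, Real.mul_self_sqrt (hl0 i)]
      have hne : (Real.sqrt (l i) : ℂ) ≠ 0 := by
        intro h; rw [h] at hs; apply hi; simpa using hs.symm
      rw [← hs]; simp; field_simp
    · simp
  obtain ⟨f, hf⟩ := hw.exists_orthonormalBasis_extension_of_card_eq (by simp)
  refine ⟨(Matrix.of fun i j => f j i)ᴴ, Unitary.star_mem f.of_mem_unitaryGroup,
    (Matrix.of fun i j => e j i), e.of_mem_unitaryGroup, fun i => Real.sqrt (l i),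
    fun i => Real.sqrt_nonneg _, ?_⟩
  apply conjTranspose_mul_mul_eq_diagonal
  intro j
  by_cases hj : l j = 0
  · have h0 := hin j j
    rw [if_pos rfl, hj, Complex.ofReal_zero, inner_self_eq_zero] at h0
    have h1 : M *ᵥ (e j) = 0 := by simpa using h0
    rw [h1]; simp [hj]
  · rw [hf j hj]
    have hne : (Real.sqrt (l j) : ℂ) ≠ 0 := by
      exact_mod_cast (Real.sqrt_pos.mpr (lt_of_le_of_ne (hl0 j) (Ne.symm hj))).ne'
    simp only [w, WithLp.ofLp_smul, smul_smul]
    rw [mul_inv_cancel₀ hne, one_smul]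

/-- A pairwise commuting family of Hermitian matrices is simultaneously unitarily diagonalizable. -/
lemma exists_unitary_forall_isDiag {ι : Type*} (H : ι → Matrix n n ℂ)
    (hH : ∀ i, (H i).IsHermitian) (hc : ∀ i j, Commute (H i) (H j)) :
    ∃ W ∈ Matrix.unitaryGroup n ℂ, ∀ i, (Wᴴ * H i * W).IsDiag := by
  classical
  let T : ι → EuclideanSpace ℂ n →ₗ[ℂ] EuclideanSpace ℂ n := fun i => Matrix.toEuclideanLin (H i)
  have hT : ∀ i, (T i).IsSymmetric := fun i => Matrix.isSymmetric_toEuclideanLin_iff.mpr (hH i)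
  have hC : Pairwise (Function.onFun Commute T) := by
    intro i j _
    change T i * T j = T j * T i
    have h := congrArg (Matrix.toEuclideanLin) (hc i j).eq
    rw [Matrix.toLpLin_mul_same, Matrix.toLpLin_mul_same] at h
    exact h
  have hI := LinearMap.IsSymmetric.directSum_isInternal_of_pairwise_commute hT hC
  have hO := LinearMap.IsSymmetric.orthogonalFamily_iInf_eigenspaces hT
  -- Joint eigenspaces are indexed by all of `ι → ℂ`; only finitely many are nonzero, and only those
  -- can carry a finite orthonormal basis.
  have hfin := WellFoundedGT.finite_ne_bot_of_iSupIndep hI.submodule_iSupIndep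
  have hI' := DirectSum.isInternal_ne_bot_iff.mpr hI
  have : Fintype {α : ι → ℂ // (⨅ j, Module.End.eigenspace (T j) (α j)) ≠ ⊥} := hfin.fintype
  have hO' := hO.comp (Subtype.val_injective
    (p := fun α : ι → ℂ => (⨅ j, Module.End.eigenspace (T j) (α j)) ≠ ⊥))
  have hn : Module.finrank ℂ (EuclideanSpace ℂ n) = Fintype.card n := by simp
  let e₀ := hI'.subordinateOrthonormalBasis hn hO'
  let e := e₀.reindex (Fintype.equivFin n).symm
  refine ⟨_, e.of_mem_unitaryGroup, fun i => ?_⟩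
  have key : ∀ j, ∃ c : ℂ, H i *ᵥ (e j) = c • (e j : n → ℂ) := by
    intro j
    have h1 := hI'.subordinateOrthonormalBasis_subordinate hn (Fintype.equivFin n j) hO'
    have h2 := (Submodule.mem_iInf _).mp h1 i
    rw [Module.End.mem_eigenspace_iff] at h2
    refine ⟨(hI'.subordinateOrthonormalBasisIndex hn (Fintype.equivFin n j) hO').1 i, ?_⟩
    have h3 := congrArg WithLp.ofLp h2
    simpa [T, e, e₀] using h3
  choose c hcc using key
  rw [conjTranspose_mul_mul_eq_diagonal e e (H i) c hcc]
  exact Matrix.isDiag_diagonal c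

/-- Two positive definite matrices are simultaneously diagonalizable by congruence. -/
lemma Matrix.PosDef.exists_congruence {h h' : Matrix n n ℂ} (hh : h.PosDef) (hh' : h'.PosDef) :
    ∃ C D : Matrix n n ℂ, C * D = 1 ∧ ∃ d : n → ℝ, (∀ i, 0 < d i) ∧
      Cᴴ * h * C = 1 ∧ Cᴴ * h' * C = Matrix.diagonal fun i => (d i : ℂ) := by
  have spec : ∀ {g : Matrix n n ℂ} (hg : g.PosDef), ∃ W ∈ Matrix.unitaryGroup n ℂ,
      ∃ d : n → ℝ, (∀ i, 0 < d i) ∧ Wᴴ * g * W = Matrix.diagonal fun i => (d i : ℂ) := by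
    intro g hg
    refine ⟨hg.isHermitian.eigenvectorUnitary, hg.isHermitian.eigenvectorUnitary.2,
      hg.isHermitian.eigenvalues, hg.eigenvalues_pos, ?_⟩
    have := hg.isHermitian.conjStarAlgAut_star_eigenvectorUnitary
    simpa [Unitary.conjStarAlgAut_star_apply, Matrix.star_eq_conjTranspose] using! this
  obtain ⟨V, hV, l, hl, hVl⟩ := spec hh
  have hs : ∀ i, ((Real.sqrt (l i) : ℂ)) ≠ 0 := fun i => by
    exact_mod_cast (Real.sqrt_pos.mpr (hl i)).ne'
  have hss : ∀ i, ((Real.sqrt (l i) : ℂ)) * (Real.sqrt (l i) : ℂ) = l i := fun i => by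
    rw [← Complex.ofReal_mul, Real.mul_self_sqrt (hl i).le]
  -- `V * E` turns `h` into the identity. A further unitary congruence preserves that, and is spent
  -- on diagonalizing the transformed `h'`.
  let E : Matrix n n ℂ := Matrix.diagonal fun i => ((Real.sqrt (l i) : ℂ))⁻¹
  let F : Matrix n n ℂ := Matrix.diagonal fun i => (Real.sqrt (l i) : ℂ)
  have hEF : E * F = 1 := by
    simp only [E, F, Matrix.diagonal_mul_diagonal]
    rw [← Matrix.diagonal_one]; congr 1; ext i; exact inv_mul_cancel₀ (hs i)
  have hEH : Eᴴ = E := by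
    simp only [E, Matrix.diagonal_conjTranspose]; congr 1; ext i; simp
  have hVV : V * Vᴴ = 1 := Matrix.mem_unitaryGroup_iff.mp hV
  have hC0 : (V * E) * (F * Vᴴ) = 1 := by
    rw [mul_assoc, ← mul_assoc E, hEF, one_mul, hVV]
  have h1 : (V * E)ᴴ * h * (V * E) = 1 := by
    rw [Matrix.conjTranspose_mul, hEH]
    calc E * Vᴴ * h * (V * E) = E * (Vᴴ * h * V) * E := by simp only [mul_assoc]
      _ = 1 := by
        rw [hVl]; simp only [E, Matrix.diagonal_mul_diagonal]
        rw [← Matrix.diagonal_one]; congr 1; ext i; rw [← hss i]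
        have := hs i; field_simp
  have hinj : Function.Injective (V * E).mulVec :=
    Matrix.mulVec_injective_of_isUnit (IsUnit.of_mul_eq_one _ hC0)
  obtain ⟨W, hW, d, hd, hWd⟩ := spec (hh'.conjTranspose_mul_mul_same hinj)
  have hWW : W * Wᴴ = 1 := Matrix.mem_unitaryGroup_iff.mp hW
  have hWW' : Wᴴ * W = 1 := Matrix.mem_unitaryGroup_iff'.mp hW
  refine ⟨V * E * W, Wᴴ * (F * Vᴴ), ?_, d, hd, ?_, ?_⟩
  · rw [mul_assoc (V * E), ← mul_assoc W, hWW, one_mul, hC0]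
  · rw [Matrix.conjTranspose_mul]
    calc Wᴴ * (V * E)ᴴ * h * (V * E * W) = Wᴴ * ((V * E)ᴴ * h * (V * E)) * W := by
          simp only [mul_assoc]
      _ = 1 := by rw [h1, mul_one, hWW']
  · rw [← hWd, Matrix.conjTranspose_mul]; simp only [mul_assoc]

end LinearAlgebra

lemma isDiag_sum {ι m : Type*} (s : Finset ι) {M : ι → Matrix m m ℂ} (h : ∀ i, (M i).IsDiag) :
    (∑ i ∈ s, M i).IsDiag := by
  intro i j hij
  rw [Matrix.sum_apply]
  exact Finset.sum_eq_zero fun k _ => h k hij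

/-! ### Pairs of matrices diagonal in two orthonormal bases. -/

section PairDiagonalization

variable {n : Type*} [Fintype n] [DecidableEq n]

/-- If `PᴴP + QᴴQ = 1` and `p PPᴴ + q QQᴴ = 1` with positive weights, then `PPᴴ + QQᴴ = 1`. -/
lemma mul_conjTranspose_add_eq_one_of_weighted {P Q : Matrix n n ℂ} {p q : ℝ} (hp : 0 < p)
    (hq : 0 < q) (h : Pᴴ * P + Qᴴ * Q = 1)
    (h' : (p : ℂ) • (P * Pᴴ) + (q : ℂ) • (Q * Qᴴ) = 1) : P * Pᴴ + Q * Qᴴ = 1 := by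
  rcases isEmpty_or_nonempty n with hn | hn
  · ext i; exact hn.elim i
  set Y := P * Pᴴ with hY
  have hQ : Qᴴ * Q = 1 - Pᴴ * P := by rw [← h]; abel
  have hQ' : (q : ℂ) • (Q * Qᴴ) = 1 - (p : ℂ) • Y := by rw [← h']; abel
  have hq0 : (q : ℂ) ≠ 0 := by exact_mod_cast hq.ne'
  set N : ℂ := (Fintype.card n : ℂ) with hN
  have hN0 : N ≠ 0 := by simp [hN]
  set τ₁ := Matrix.trace Y with hτ₁
  set τ₂ := Matrix.trace (Y * Y) with hτ₂
  -- `QᴴQ` and `QQᴴ` have powers of equal trace, and likewise for `P`. Comparing first and second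
  -- powers eliminates `Q` and gives two equations in the moments `τ₁`, `τ₂` of `Y`.
  have e1 : (q : ℂ) * (N - τ₁) = N - p * τ₁ := by
    have h1 : Matrix.trace (Qᴴ * Q) = N - τ₁ := by
      rw [hQ, Matrix.trace_sub, Matrix.trace_one, Matrix.trace_mul_comm Pᴴ P]
    have h2 : (q : ℂ) * Matrix.trace (Q * Qᴴ) = N - p * τ₁ := by
      rw [← smul_eq_mul, ← Matrix.trace_smul, hQ', Matrix.trace_sub, Matrix.trace_one,
        Matrix.trace_smul, smul_eq_mul]
    rw [← h2, Matrix.trace_mul_comm Q, h1]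
  have e2 : (q : ℂ) ^ 2 * (N - 2 * τ₁ + τ₂) = N - 2 * p * τ₁ + p ^ 2 * τ₂ := by
    have hcyc : ∀ A : Matrix n n ℂ,
        Matrix.trace ((Aᴴ * A) * (Aᴴ * A)) = Matrix.trace ((A * Aᴴ) * (A * Aᴴ)) := by
      intro A
      rw [mul_assoc, Matrix.trace_mul_comm]; simp only [mul_assoc]
    have h1 : Matrix.trace ((Qᴴ * Q) * (Qᴴ * Q)) = N - 2 * τ₁ + τ₂ := by
      rw [hQ]
      have : (1 - Pᴴ * P) * (1 - Pᴴ * P) = 1 - (2 : ℂ) • (Pᴴ * P) + (Pᴴ * P) * (Pᴴ * P) := by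
        rw [two_smul]; noncomm_ring
      rw [this, Matrix.trace_add, Matrix.trace_sub, Matrix.trace_one, Matrix.trace_smul, hcyc P,
        Matrix.trace_mul_comm Pᴴ P, smul_eq_mul]
    have h2 : (q : ℂ) ^ 2 * Matrix.trace ((Q * Qᴴ) * (Q * Qᴴ)) = N - 2 * p * τ₁ + p ^ 2 * τ₂ := by
      have h3 : ((q : ℂ) • (Q * Qᴴ)) * ((q : ℂ) • (Q * Qᴴ)) =
          ((q : ℂ) ^ 2) • ((Q * Qᴴ) * (Q * Qᴴ)) := by
        rw [smul_mul_smul_comm, sq]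
      have h4 : (1 - (p : ℂ) • Y) * (1 - (p : ℂ) • Y) =
          1 - (2 * (p : ℂ)) • Y + ((p : ℂ) ^ 2) • (Y * Y) := by
        rw [mul_smul, two_smul, sub_mul, mul_sub, mul_sub, smul_mul_smul_comm, sq]
        simp only [one_mul, mul_one]; abel
      rw [← smul_eq_mul, ← Matrix.trace_smul, ← h3, hQ', h4, Matrix.trace_add, Matrix.trace_sub,
        Matrix.trace_one, Matrix.trace_smul, Matrix.trace_smul, smul_eq_mul, smul_eq_mul]
    rw [← h2, ← hcyc, h1]
  have key : (q : ℂ) • (1 - Y) = 1 - (p : ℂ) • Y := by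
    by_cases hpq : p = q
    · subst hpq
      have : ((p : ℂ) - 1) * N = 0 := by linear_combination e1
      have hp1 : (p : ℂ) = 1 := by
        rcases mul_eq_zero.mp this with h | h
        · linear_combination h
        · exact absurd h hN0
      rw [hp1, one_smul, one_smul]
    -- The square of `e1` subtracted from `N` times `e2`. For `p ≠ q` this is equality in
    -- Cauchy–Schwarz for the eigenvalues of `Y`, so `Y` is scalar.
    · have h3 : ((q : ℂ) - p) * (((q : ℂ) + p) * (N * τ₂ - τ₁ ^ 2)) = 0 := by
        linear_combination N * e2 - ((q : ℂ) * (N - τ₁) + (N - p * τ₁)) * e1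
      have h4 : ((q : ℂ) - p) ≠ 0 := by
        rw [sub_ne_zero]; exact_mod_cast Ne.symm hpq
      have h5 : ((q : ℂ) + p) ≠ 0 := by exact_mod_cast (add_pos hq hp).ne'
      have h6 : N * τ₂ - τ₁ ^ 2 = 0 := by simpa [h4, h5] using h3
      have hYH : Yᴴ = Y := by simp [hY]
      have hτH : star τ₁ = τ₁ := by rw [hτ₁, ← Matrix.trace_conjTranspose, hYH]
      have hNH : star N = N := by simp [hN]
      have h7 : N • Y - τ₁ • (1 : Matrix n n ℂ) = 0 := by
        rw [← Matrix.trace_conjTranspose_mul_self_eq_zero_iff]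
        have : (N • Y - τ₁ • (1 : Matrix n n ℂ))ᴴ * (N • Y - τ₁ • (1 : Matrix n n ℂ)) =
            (N ^ 2) • (Y * Y) - (2 * N * τ₁) • Y + (τ₁ ^ 2) • (1 : Matrix n n ℂ) := by
          rw [Matrix.conjTranspose_sub, Matrix.conjTranspose_smul, Matrix.conjTranspose_smul,
            hYH, hτH, hNH, Matrix.conjTranspose_one, sub_mul, mul_sub, mul_sub]
          simp only [smul_mul_smul_comm, one_mul, mul_one, sq]
          rw [mul_comm τ₁ N, two_mul, add_mul, add_smul]; abel
        rw [this, Matrix.trace_add, Matrix.trace_sub, Matrix.trace_smul, Matrix.trace_smul,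
          Matrix.trace_smul, Matrix.trace_one]
        simp only [smul_eq_mul]
        linear_combination N * h6
      have h8 : Y = (N⁻¹ * τ₁) • (1 : Matrix n n ℂ) := by
        rw [mul_smul, ← sub_eq_zero.mp h7, smul_smul, inv_mul_cancel₀ hN0, one_smul]
      rw [h8]
      have h9 : (q : ℂ) - q * (N⁻¹ * τ₁) = 1 - p * (N⁻¹ * τ₁) := by
        field_simp; linear_combination e1
      rw [smul_sub, smul_smul, smul_smul, sub_eq_sub_iff_add_eq_add]
      rw [← add_smul]
      nth_rewrite 2 [← one_smul ℂ (1 : Matrix n n ℂ)]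
      rw [← add_smul]; congr 1; linear_combination h9
  have : (q : ℂ) • (Q * Qᴴ) = (q : ℂ) • (1 - Y) := by rw [hQ', key]
  have h10 : Q * Qᴴ = 1 - Y := smul_right_injective _ hq0 this
  rw [h10]; abel

/-- Commuting matrices, one Hermitian and one normal, are simultaneously diagonalizable. -/
lemma exists_unitary_isDiag_isDiag {P Q : Matrix n n ℂ} (hP : P.IsHermitian)
    (hQ : Qᴴ * Q = Q * Qᴴ) (hc : Commute P Q) :
    ∃ W ∈ Matrix.unitaryGroup n ℂ, (Wᴴ * P * W).IsDiag ∧ (Wᴴ * Q * W).IsDiag := by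
  have hc' : Commute P Qᴴ := by
    have := congrArg conjTranspose hc.eq
    rw [conjTranspose_mul, conjTranspose_mul, hP.eq] at this
    exact this.symm
  have hQc : Commute Q Qᴴ := hQ.symm
  -- A normal matrix is a combination of two commuting Hermitian ones, which reduces the claim to a
  -- commuting Hermitian family.
  have hAB : Commute (Q + Qᴴ) (Complex.I • (Q - Qᴴ)) :=
    (((Commute.refl Q).sub_right hQc).add_left (hQc.symm.sub_right (Commute.refl _))).smul_right _
  have hPA : Commute P (Q + Qᴴ) := hc.add_right hc'
  have hPB : Commute P (Complex.I • (Q - Qᴴ)) := (hc.sub_right hc').smul_right _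
  obtain ⟨W, hW, hd⟩ := exists_unitary_forall_isDiag
    (![P, Q + Qᴴ, Complex.I • (Q - Qᴴ)] : Fin 3 → Matrix n n ℂ) (by
      intro i; fin_cases i
      · exact hP
      · change (Q + Qᴴ)ᴴ = Q + Qᴴ
        rw [conjTranspose_add, conjTranspose_conjTranspose, add_comm]
      · change (Complex.I • (Q - Qᴴ))ᴴ = Complex.I • (Q - Qᴴ)
        rw [conjTranspose_smul, conjTranspose_sub, conjTranspose_conjTranspose]
        simp only [RCLike.star_def, Complex.conj_I, neg_smul]
        rw [← smul_neg, neg_sub]) (by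
      intro i j; fin_cases i <;> fin_cases j
      · exact Commute.refl _
      · exact hPA
      · exact hPB
      · exact hPA.symm
      · exact Commute.refl _
      · exact hAB
      · exact hPB.symm
      · exact hAB.symm
      · exact Commute.refl _)
  refine ⟨W, hW, hd 0, ?_⟩
  have h1 : (Wᴴ * (Q + Qᴴ) * W).IsDiag := hd 1
  have h2 : (Wᴴ * (Complex.I • (Q - Qᴴ)) * W).IsDiag := hd 2
  have h3 : Q = (1 / 2 : ℂ) • (Q + Qᴴ) + (-(Complex.I) / 2) • (Complex.I • (Q - Qᴴ)) := by
    rw [smul_smul]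
    have : -Complex.I / 2 * Complex.I = 1 / 2 := by
      linear_combination (-1 / 2 : ℂ) * Complex.I_mul_I
    rw [this, ← smul_add]
    have h4 : Q + Qᴴ + (Q - Qᴴ) = (2 : ℂ) • Q := by rw [two_smul]; abel
    rw [h4, smul_smul]; norm_num
  have h5 : Wᴴ * Q * W = (1 / 2 : ℂ) • (Wᴴ * (Q + Qᴴ) * W) +
      (-(Complex.I) / 2) • (Wᴴ * (Complex.I • (Q - Qᴴ)) * W) := by
    conv_lhs => rw [h3]
    simp only [mul_add, add_mul, Matrix.mul_smul, Matrix.smul_mul]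
  rw [h5]
  exact (h1.smul _).add (h2.smul _)

lemma conjTranspose_mul_self_mul_mul {Q R : Matrix n n ℂ} (hQ : Q ∈ Matrix.unitaryGroup n ℂ)
    (M : Matrix n n ℂ) : (Q * M * R)ᴴ * (Q * M * R) = Rᴴ * (Mᴴ * M) * R := by
  have hQ' : Qᴴ * Q = 1 := Matrix.mem_unitaryGroup_iff'.mp hQ
  calc (Q * M * R)ᴴ * (Q * M * R) = Rᴴ * (Mᴴ * ((Qᴴ * Q) * M)) * R := by
        simp only [conjTranspose_mul, mul_assoc]
    _ = _ := by rw [hQ', one_mul]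

lemma mul_mul_mul_conjTranspose_self {Q R : Matrix n n ℂ} (hR : R ∈ Matrix.unitaryGroup n ℂ)
    (M : Matrix n n ℂ) : (Q * M * R) * (Q * M * R)ᴴ = Q * (M * Mᴴ) * Qᴴ := by
  have hR' : R * Rᴴ = 1 := Matrix.mem_unitaryGroup_iff.mp hR
  calc (Q * M * R) * (Q * M * R)ᴴ = Q * (M * ((R * Rᴴ) * Mᴴ)) * Qᴴ := by
        simp only [conjTranspose_mul, mul_assoc]
    _ = _ := by rw [hR', one_mul]

/-- Two matrices with `PᴴP + QᴴQ = 1 = PPᴴ + QQᴴ` are simultaneously diagonal in suitable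
orthonormal bases. -/
lemma exists_unitary_isDiag_of_add_eq_one {P Q : Matrix n n ℂ} (h : Pᴴ * P + Qᴴ * Q = 1)
    (h' : P * Pᴴ + Q * Qᴴ = 1) :
    ∃ A ∈ Matrix.unitaryGroup n ℂ, ∃ B ∈ Matrix.unitaryGroup n ℂ,
      (A * P * B).IsDiag ∧ (A * Q * B).IsDiag := by
  obtain ⟨A, hA, B, hB, t, ht, hPt⟩ := exists_unitary_mul_mul_eq_diagonal P
  have hA' : A * Aᴴ = 1 := Matrix.mem_unitaryGroup_iff.mp hA
  have hB' : Bᴴ * B = 1 := Matrix.mem_unitaryGroup_iff'.mp hB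
  set D : Matrix n n ℂ := Matrix.diagonal fun i => (t i : ℂ) with hD
  have hDH : Dᴴ = D := by
    rw [hD, Matrix.diagonal_conjTranspose]; congr 1; ext i; simp
  set X := A * Q * B with hX
  have e1 : D * D + Xᴴ * X = 1 := by
    have : Dᴴ * D + Xᴴ * X = 1 := by
      rw [← hPt, hX, conjTranspose_mul_self_mul_mul hA, conjTranspose_mul_self_mul_mul hA,
        ← add_mul, ← mul_add, h, mul_one, hB']
    rwa [hDH] at this
  have e2 : D * D + X * Xᴴ = 1 := by
    have : D * Dᴴ + X * Xᴴ = 1 := by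
      rw [← hPt, hX, mul_mul_mul_conjTranspose_self hB, mul_mul_mul_conjTranspose_self hB,
        ← add_mul, ← mul_add, h', mul_one, hA']
    rwa [hDH] at this
  -- After the singular value decomposition of `P`, the transformed `Q` is normal and commutes with
  -- `D * D`; since the entries of `D` are nonnegative, it commutes with `D` itself.
  have e3 : Xᴴ * X = X * Xᴴ := add_left_cancel (e1.trans e2.symm)
  have e4 : (D * D) * X = X * (D * D) := by
    have f1 : D * D = 1 - Xᴴ * X := by rw [← e1]; abel
    have f2 : D * D = 1 - X * Xᴴ := by rw [← e2]; abel
    calc (D * D) * X = (1 - X * Xᴴ) * X := by rw [f2]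
      _ = X * (1 - Xᴴ * X) := by noncomm_ring
      _ = X * (D * D) := by rw [f1]
  have hc : Commute D X := by
    change D * X = X * D
    ext i j
    have := congrFun (congrFun e4 i) j
    rw [hD, Matrix.diagonal_mul_diagonal, Matrix.diagonal_mul, Matrix.mul_diagonal] at this
    rw [hD, Matrix.diagonal_mul, Matrix.mul_diagonal]
    by_cases hx : X i j = 0
    · simp [hx]
    · rw [mul_comm (X i j)] at this ⊢
      have h1 : (t i : ℂ) * t i = t j * t j := mul_right_cancel₀ hx this
      have h2 : t i * t i = t j * t j := by exact_mod_cast h1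
      have h3 : t i = t j := by
        rw [← Real.sqrt_mul_self (ht i), ← Real.sqrt_mul_self (ht j), h2]
      rw [h3]
  obtain ⟨W, hW, hd1, hd2⟩ := exists_unitary_isDiag_isDiag hDH e3 hc
  refine ⟨Wᴴ * A, mul_mem (Unitary.star_mem hW) hA, B * W, mul_mem hB hW, ?_, ?_⟩
  · rw [← hPt] at hd1; simpa only [mul_assoc] using hd1
  · rw [hX] at hd2; simpa only [mul_assoc] using hd2

/-- Two matrices whose weighted products sum up to the identity on both sides, with positive
definite weights, are simultaneously diagonal in suitable orthonormal bases. -/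
lemma exists_unitary_isDiag_of_posDef {h h' : Matrix (Fin 2) (Fin 2) ℂ} (hh : h.PosDef)
    (hh' : h'.PosDef) {S : Fin 2 → Matrix n n ℂ}
    (e : ∑ i, ∑ j, h i j • ((S i)ᴴ * S j) = 1)
    (e' : ∑ i, ∑ j, h' i j • (S j * (S i)ᴴ) = 1) :
    ∃ A ∈ Matrix.unitaryGroup n ℂ, ∃ B ∈ Matrix.unitaryGroup n ℂ,
      ∀ i, (A * S i * B).IsDiag := by
  obtain ⟨C, D, hCD, d, hd, hC, hC'⟩ := hh.exists_congruence hh'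
  -- The change of basis in the span of `S 0`, `S 1` which makes the first form the identity and the
  -- second one diagonal.
  let N : Fin 2 → Matrix n n ℂ := fun l => ∑ j, D l j • S j
  have hS : ∀ j, S j = ∑ l, C j l • N l := by
    intro j
    have : ∑ l, C j l • N l = ∑ i, (C * D) j i • S i := by
      simp only [N, Finset.smul_sum, smul_smul, Matrix.mul_apply, Finset.sum_smul]
      exact Finset.sum_comm
    rw [this, hCD]
    simp [Matrix.one_apply, ite_smul]
  have expand : ∀ g : Matrix (Fin 2) (Fin 2) ℂ, ∀ i j,
      (Cᴴ * g * C) i j = ∑ k, ∑ l, star (C k i) * g k l * C l j := by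
    intro g i j
    simp only [Matrix.mul_apply, Matrix.conjTranspose_apply, Finset.sum_mul]
    exact Finset.sum_comm
  have e1 : (N 0)ᴴ * N 0 + (N 1)ᴴ * N 1 = 1 := by
    have : ∑ i, ∑ j, h i j • ((S i)ᴴ * S j) =
        ∑ i, ∑ j, (Cᴴ * h * C) i j • ((N i)ᴴ * N j) := by
      simp only [expand, hS, Fin.sum_univ_two, conjTranspose_add, conjTranspose_smul, add_mul,
        mul_add, smul_mul_smul_comm, smul_add, add_smul, smul_smul]
      module
    rw [this, hC] at e
    simpa [Fin.sum_univ_two] using e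
  have e2 : ((d 0 : ℝ) : ℂ) • (N 0 * (N 0)ᴴ) + ((d 1 : ℝ) : ℂ) • (N 1 * (N 1)ᴴ) = 1 := by
    have : ∑ i, ∑ j, h' i j • (S j * (S i)ᴴ) =
        ∑ i, ∑ j, (Cᴴ * h' * C) i j • (N j * (N i)ᴴ) := by
      simp only [expand, hS, Fin.sum_univ_two, conjTranspose_add, conjTranspose_smul, add_mul,
        mul_add, smul_mul_smul_comm, smul_add, add_smul, smul_smul]
      module
    rw [this, hC'] at e'
    simpa [Fin.sum_univ_two] using e'
  obtain ⟨A, hA, B, hB, h0, h1⟩ := exists_unitary_isDiag_of_add_eq_one e1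
    (mul_conjTranspose_add_eq_one_of_weighted (hd 0) (hd 1) e1 e2)
  refine ⟨A, hA, B, hB, fun i => ?_⟩
  rw [hS i, Finset.mul_sum, Finset.sum_mul]
  refine isDiag_sum _ fun l => ?_
  rw [Matrix.mul_smul, Matrix.smul_mul]
  refine Matrix.IsDiag.smul _ ?_
  fin_cases l
  · exact h0
  · exact h1

end PairDiagonalization

/-! ### Blocks of bipartite operators and local unitaries. -/

section Bipartite

variable {a b : Type*}

/-- The block of a bipartite matrix at the position `(k, l)` of the first factor. -/
def bipartiteBlock (U : Matrix (a × b) (a × b) ℂ) (k l : a) : Matrix b b ℂ :=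
  Matrix.of fun p q => U (k, p) (l, q)

/-- Exchange of the two tensor factors. -/
def swapFactors (U : Matrix (a × b) (a × b) ℂ) : Matrix (b × a) (b × a) ℂ :=
  U.submatrix Prod.swap Prod.swap

/-- The operator `∑ i, R i ⊗ S i`. -/
def kroneckerSum {ι : Type*} [Fintype ι] (R : ι → Matrix a a ℂ) (S : ι → Matrix b b ℂ) :
    Matrix (a × b) (a × b) ℂ :=
  ∑ i, R i ⊗ₖ S i

lemma kroneckerSum_apply {ι : Type*} [Fintype ι] (R : ι → Matrix a a ℂ) (S : ι → Matrix b b ℂ)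
    (x y : a × b) : kroneckerSum R S x y = ∑ i, R i x.1 y.1 * S i x.2 y.2 := by
  simp [kroneckerSum, Matrix.sum_apply, Matrix.kroneckerMap_apply]

lemma swapFactors_kroneckerSum {ι : Type*} [Fintype ι] (R : ι → Matrix a a ℂ)
    (S : ι → Matrix b b ℂ) : swapFactors (kroneckerSum R S) = kroneckerSum S R := by
  ext x y
  simp [swapFactors, kroneckerSum_apply, mul_comm]

lemma bipartiteBlock_kroneckerSum {ι : Type*} [Fintype ι] (R : ι → Matrix a a ℂ)
    (S : ι → Matrix b b ℂ) (k l : a) :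
    bipartiteBlock (kroneckerSum R S) k l = ∑ i, R i k l • S i := by
  ext p q
  simp [bipartiteBlock, kroneckerSum_apply, Matrix.sum_apply]

lemma bipartiteBlock_conjTranspose (U : Matrix (a × b) (a × b) ℂ) (k l : a) :
    bipartiteBlock Uᴴ k l = (bipartiteBlock U l k)ᴴ := rfl

lemma kroneckerSum_conjTranspose {ι : Type*} [Fintype ι] (R : ι → Matrix a a ℂ)
    (S : ι → Matrix b b ℂ) :
    (kroneckerSum R S)ᴴ = kroneckerSum (fun i => (R i)ᴴ) (fun i => (S i)ᴴ) := by
  ext x y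
  simp [kroneckerSum_apply]

variable [Fintype a] [Fintype b]

lemma bipartiteBlock_mul (U V : Matrix (a × b) (a × b) ℂ) (k l : a) :
    bipartiteBlock (U * V) k l = ∑ m, bipartiteBlock U k m * bipartiteBlock V m l := by
  ext p q
  simp [bipartiteBlock, Matrix.sum_apply, Matrix.mul_apply, Fintype.sum_prod_type]

lemma kroneckerSum_mul_mul {ι : Type*} [Fintype ι] (R : ι → Matrix a a ℂ) (S : ι → Matrix b b ℂ)
    (A B : Matrix a a ℂ) (C D : Matrix b b ℂ) :
    kroneckerSum (fun i => A * R i * B) (fun i => C * S i * D) =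
      (A ⊗ₖ C) * kroneckerSum R S * (B ⊗ₖ D) := by
  simp only [kroneckerSum, Matrix.mul_kronecker_mul, Finset.mul_sum, Finset.sum_mul]

variable [DecidableEq a] [DecidableEq b]

lemma swapFactors_mem_unitaryGroup {U : Matrix (a × b) (a × b) ℂ}
    (hU : U ∈ Matrix.unitaryGroup (a × b) ℂ) : swapFactors U ∈ Matrix.unitaryGroup (b × a) ℂ := by
  rw [Matrix.mem_unitaryGroup_iff] at hU ⊢
  have : swapFactors U * star (swapFactors U) = (U * star U).submatrix Prod.swap Prod.swap :=
    Matrix.submatrix_mul_equiv U (star U) _ (Equiv.prodComm b a) _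
  rw [this, hU]
  exact Matrix.submatrix_one_equiv (Equiv.prodComm b a)

lemma kroneckerSum_mul_mul_mem_unitaryGroup {ι : Type*} [Fintype ι] {R : ι → Matrix a a ℂ}
    {S : ι → Matrix b b ℂ} (hU : kroneckerSum R S ∈ Matrix.unitaryGroup (a × b) ℂ)
    {A B : Matrix a a ℂ} {C D : Matrix b b ℂ} (hA : A ∈ Matrix.unitaryGroup a ℂ)
    (hB : B ∈ Matrix.unitaryGroup a ℂ) (hC : C ∈ Matrix.unitaryGroup b ℂ)
    (hD : D ∈ Matrix.unitaryGroup b ℂ) :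
    kroneckerSum (fun i => A * R i * B) (fun i => C * S i * D) ∈
      Matrix.unitaryGroup (a × b) ℂ := by
  rw [kroneckerSum_mul_mul]
  exact mul_mem (mul_mem (Matrix.kronecker_mem_unitary hA hC) hU)
    (Matrix.kronecker_mem_unitary hB hD)

lemma sum_conjTranspose_bipartiteBlock_mul {U : Matrix (a × b) (a × b) ℂ}
    (hU : U ∈ Matrix.unitaryGroup (a × b) ℂ) (k l : a) :
    ∑ m, (bipartiteBlock U m k)ᴴ * bipartiteBlock U m l = if k = l then 1 else 0 := by
  have h : Uᴴ * U = 1 := Matrix.mem_unitaryGroup_iff'.mp hU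
  simp_rw [← bipartiteBlock_conjTranspose]
  rw [← bipartiteBlock_mul, h]
  ext p q
  by_cases hkl : k = l <;> simp [bipartiteBlock, Matrix.one_apply, hkl]

lemma sum_bipartiteBlock_mul_conjTranspose {U : Matrix (a × b) (a × b) ℂ}
    (hU : U ∈ Matrix.unitaryGroup (a × b) ℂ) (k l : a) :
    ∑ m, bipartiteBlock U k m * (bipartiteBlock U l m)ᴴ = if k = l then 1 else 0 := by
  have h : U * Uᴴ = 1 := Matrix.mem_unitaryGroup_iff.mp hU
  simp_rw [← bipartiteBlock_conjTranspose]
  rw [← bipartiteBlock_mul, h]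
  ext p q
  by_cases hkl : k = l <;> simp [bipartiteBlock, Matrix.one_apply, hkl]

/-- All blocks of `U` are diagonal in common orthonormal bases of the second factor. -/
def HasDiagonalBlocks (U : Matrix (a × b) (a × b) ℂ) : Prop :=
  ∃ Q ∈ Matrix.unitaryGroup b ℂ, ∃ R ∈ Matrix.unitaryGroup b ℂ,
    ∀ k l, (Q * bipartiteBlock U k l * R).IsDiag

lemma HasDiagonalBlocks.of_forall {ι : Type*} [Fintype ι] (R : ι → Matrix a a ℂ)
    {S : ι → Matrix b b ℂ} {C D : Matrix b b ℂ} (hC : C ∈ Matrix.unitaryGroup b ℂ)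
    (hD : D ∈ Matrix.unitaryGroup b ℂ) (h : ∀ i, (C * S i * D).IsDiag) :
    HasDiagonalBlocks (kroneckerSum R S) := by
  refine ⟨C, hC, D, hD, fun k l => ?_⟩
  rw [bipartiteBlock_kroneckerSum, Finset.mul_sum, Finset.sum_mul]
  refine isDiag_sum _ fun i => ?_
  rw [Matrix.mul_smul, Matrix.smul_mul]
  exact (h i).smul _

/-- In suitable orthonormal bases of the second factor, the entries of all blocks of `U` at the
positions in `Z` vanish. -/
def BlocksVanish (Z : b → b → Prop) (U : Matrix (a × b) (a × b) ℂ) : Prop :=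
  ∃ Q ∈ Matrix.unitaryGroup b ℂ, ∃ R ∈ Matrix.unitaryGroup b ℂ,
    ∀ k l p q, Z p q → (Q * bipartiteBlock U k l * R) p q = 0

lemma hasDiagonalBlocks_iff {U : Matrix (a × b) (a × b) ℂ} :
    HasDiagonalBlocks U ↔ BlocksVanish (fun p q => p ≠ q) U := Iff.rfl

/-- `BlocksVanish` is invariant under local unitaries. -/
lemma BlocksVanish.of_local {Z : b → b → Prop} {ι : Type*} [Fintype ι] {R : ι → Matrix a a ℂ}
    {S : ι → Matrix b b ℂ} {A B : Matrix a a ℂ} {C D : Matrix b b ℂ}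
    (hA : A ∈ Matrix.unitaryGroup a ℂ) (hB : B ∈ Matrix.unitaryGroup a ℂ)
    (hC : C ∈ Matrix.unitaryGroup b ℂ) (hD : D ∈ Matrix.unitaryGroup b ℂ)
    (h : BlocksVanish Z (kroneckerSum (fun i => A * R i * B) (fun i => C * S i * D))) :
    BlocksVanish Z (kroneckerSum R S) := by
  obtain ⟨Q, hQ, W, hW, hd⟩ := h
  refine ⟨Q * C, mul_mem hQ hC, D * W, mul_mem hD hW, fun k l p q hpq => ?_⟩
  have hA' : Aᴴ * A = 1 := Matrix.mem_unitaryGroup_iff'.mp hA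
  have hB' : B * Bᴴ = 1 := Matrix.mem_unitaryGroup_iff.mp hB
  -- Unitaries on the first factor only mix the blocks linearly, and vanishing at fixed positions
  -- survives linear combinations.
  have hR : ∀ i, R i k l = ∑ x, ∑ y, Aᴴ k x * (A * R i * B) x y * Bᴴ y l := by
    intro i
    have : R i = Aᴴ * (A * R i * B) * Bᴴ := by
      rw [mul_assoc A, ← mul_assoc Aᴴ, hA', one_mul, mul_assoc, hB', mul_one]
    conv_lhs => rw [this]
    simp only [Matrix.mul_apply (M := Aᴴ * (A * R i * B)), Matrix.mul_apply (M := Aᴴ),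
      Finset.sum_mul]
    exact Finset.sum_comm
  have key : Q * C * bipartiteBlock (kroneckerSum R S) k l * (D * W) =
      ∑ x, ∑ y, (Aᴴ k x * Bᴴ y l) • (Q * bipartiteBlock
        (kroneckerSum (fun i => A * R i * B) (fun i => C * S i * D)) x y * W) := by
    simp only [bipartiteBlock_kroneckerSum, Finset.mul_sum, Finset.sum_mul, Matrix.mul_smul,
      Matrix.smul_mul, Finset.smul_sum, smul_smul]
    simp only [← Finset.sum_comm (s := (Finset.univ : Finset ι))]
    refine Finset.sum_congr rfl fun i _ => ?_
    rw [hR i, Finset.sum_smul]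
    refine Finset.sum_congr rfl fun x _ => ?_
    rw [Finset.sum_smul]
    refine Finset.sum_congr rfl fun y _ => ?_
    simp only [mul_assoc]
    congr 1
    ring
  rw [key, Matrix.sum_apply]
  refine Finset.sum_eq_zero fun x _ => ?_
  rw [Matrix.sum_apply]
  refine Finset.sum_eq_zero fun y _ => ?_
  rw [Matrix.smul_apply, hd x y p q hpq, smul_zero]

lemma BlocksVanish.of_conjTranspose {Z : b → b → Prop} (hZ : ∀ p q, Z p q → Z q p)
    {U : Matrix (a × b) (a × b) ℂ} (h : BlocksVanish Z Uᴴ) : BlocksVanish Z U := by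
  obtain ⟨Q, hQ, W, hW, hd⟩ := h
  refine ⟨Wᴴ, Unitary.star_mem hW, Qᴴ, Unitary.star_mem hQ, fun k l p q hpq => ?_⟩
  have h1 : Wᴴ * bipartiteBlock U k l * Qᴴ = (Q * bipartiteBlock Uᴴ l k * W)ᴴ := by
    rw [bipartiteBlock_conjTranspose]
    simp only [conjTranspose_mul, conjTranspose_conjTranspose, mul_assoc]
  rw [h1, conjTranspose_apply, hd l k q p (hZ p q hpq), star_zero]

/-- `HasDiagonalBlocks` is invariant under local unitaries. -/
lemma HasDiagonalBlocks.of_local {ι : Type*} [Fintype ι] {R : ι → Matrix a a ℂ}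
    {S : ι → Matrix b b ℂ} {A B : Matrix a a ℂ} {C D : Matrix b b ℂ}
    (hA : A ∈ Matrix.unitaryGroup a ℂ) (hB : B ∈ Matrix.unitaryGroup a ℂ)
    (hC : C ∈ Matrix.unitaryGroup b ℂ) (hD : D ∈ Matrix.unitaryGroup b ℂ)
    (h : HasDiagonalBlocks (kroneckerSum (fun i => A * R i * B) (fun i => C * S i * D))) :
    HasDiagonalBlocks (kroneckerSum R S) :=
  hasDiagonalBlocks_iff.mpr (BlocksVanish.of_local hA hB hC hD (hasDiagonalBlocks_iff.mp h))

/-- Unitary matrices in a two-dimensional space of matrices are simultaneously diagonal in suitable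
orthonormal bases. -/
lemma exists_unitary_isDiag_of_mem_span_pair {V : a → Matrix b b ℂ}
    (hV : ∀ k, V k ∈ Matrix.unitaryGroup b ℂ) {α β : a → ℂ} {T₀ T₁ : Matrix b b ℂ}
    (hT : ∀ k, V k = α k • T₀ + β k • T₁) :
    ∃ Q ∈ Matrix.unitaryGroup b ℂ, ∃ R ∈ Matrix.unitaryGroup b ℂ,
      ∀ k, (Q * V k * R).IsDiag := by
  rcases isEmpty_or_nonempty a with ha | ⟨⟨k₀⟩⟩
  · exact ⟨1, one_mem _, 1, one_mem _, fun k => ha.elim k⟩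
  have h0 : (V k₀)ᴴ * V k₀ = 1 := Matrix.mem_unitaryGroup_iff'.mp (hV k₀)
  by_cases hall : ∀ k, ∃ c : ℂ, V k = c • V k₀
  · refine ⟨(V k₀)ᴴ, Unitary.star_mem (hV k₀), 1, one_mem _, fun k => ?_⟩
    obtain ⟨c, hc⟩ := hall k
    rw [hc, mul_one, Matrix.mul_smul, h0]
    exact Matrix.isDiag_one.smul c
  · push Not at hall
    obtain ⟨k₁, hk₁⟩ := hall
    have hΔ : α k₀ * β k₁ - α k₁ * β k₀ ≠ 0 := by
      intro hΔ
      have e1 : α k₀ • V k₁ = α k₁ • V k₀ := by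
        rw [← sub_eq_zero]
        calc α k₀ • V k₁ - α k₁ • V k₀ = (α k₀ * β k₁ - α k₁ * β k₀) • T₁ := by
              rw [hT k₀, hT k₁]; module
          _ = 0 := by rw [hΔ, zero_smul]
      have e2 : β k₀ • V k₁ = β k₁ • V k₀ := by
        rw [← sub_eq_zero]
        calc β k₀ • V k₁ - β k₁ • V k₀ = -(α k₀ * β k₁ - α k₁ * β k₀) • T₀ := by
              rw [hT k₀, hT k₁]; module
          _ = 0 := by rw [hΔ, neg_zero, zero_smul]
      by_cases hα : α k₀ = 0
      · by_cases hβ : β k₀ = 0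
        · have hV0 : V k₀ = 0 := by rw [hT k₀, hα, hβ]; simp
          apply hk₁ 0
          rw [hV0, mul_zero] at h0
          rw [zero_smul, ← one_mul (V k₁), ← h0, zero_mul]
        · apply hk₁ ((β k₀)⁻¹ * β k₁)
          rw [mul_smul, ← e2, smul_smul, inv_mul_cancel₀ hβ, one_smul]
      · apply hk₁ ((α k₀)⁻¹ * α k₁)
        rw [mul_smul, ← e1, smul_smul, inv_mul_cancel₀ hα, one_smul]
    -- Two non-proportional members span the rest (Cramer's rule with determinant `hΔ`). Multiplying
    -- by `(V k₀)ᴴ` turns them into the identity and one unitary, hence normal, matrix.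
    have hX : (V k₀)ᴴ * V k₁ ∈ Matrix.unitaryGroup b ℂ :=
      mul_mem (Unitary.star_mem (hV k₀)) (hV k₁)
    have hX1 := Matrix.mem_unitaryGroup_iff'.mp hX
    have hX2 := Matrix.mem_unitaryGroup_iff.mp hX
    -- The Hermitian partner is a dummy `0`: only the normal matrix matters.
    obtain ⟨W, hW, -, hd⟩ := exists_unitary_isDiag_isDiag (P := (0 : Matrix b b ℂ))
      Matrix.isHermitian_zero (hX1.trans hX2.symm) (Commute.zero_left _)
    have hWW : Wᴴ * W = 1 := Matrix.mem_unitaryGroup_iff'.mp hW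
    have d0 : (Wᴴ * (V k₀)ᴴ * V k₀ * W).IsDiag := by
      rw [mul_assoc Wᴴ, h0, mul_one, hWW]; exact Matrix.isDiag_one
    have d1 : (Wᴴ * (V k₀)ᴴ * V k₁ * W).IsDiag := by
      rw [mul_assoc Wᴴ]; exact hd
    refine ⟨Wᴴ * (V k₀)ᴴ, mul_mem (Unitary.star_mem hW) (Unitary.star_mem (hV k₀)), W, hW,
      fun k => ?_⟩
    have e : V k = ((α k₀ * β k₁ - α k₁ * β k₀)⁻¹ * (α k * β k₁ - α k₁ * β k)) • V k₀ +
        ((α k₀ * β k₁ - α k₁ * β k₀)⁻¹ * (α k₀ * β k - α k * β k₀)) • V k₁ := by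
      rw [mul_smul, mul_smul, ← smul_add]
      have : (α k * β k₁ - α k₁ * β k) • V k₀ + (α k₀ * β k - α k * β k₀) • V k₁ =
          (α k₀ * β k₁ - α k₁ * β k₀) • V k := by
        rw [hT k, hT k₀, hT k₁]; module
      rw [this, smul_smul, inv_mul_cancel₀ hΔ, one_smul]
    rw [e, mul_add, add_mul, Matrix.mul_smul, Matrix.smul_mul, Matrix.mul_smul, Matrix.smul_mul]
    exact (d0.smul _).add (d1.smul _)

/-- A linear dependence between three vectors puts them into the span of two. -/
lemma exists_pair_of_sum_smul_eq_zero {M : Type*} [AddCommGroup M] [Module ℂ M] {S : Fin 3 → M}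
    {w : Fin 3 → ℂ} (hw : w ≠ 0) (h : ∑ i, w i • S i = 0) :
    ∃ T₀ T₁ : M, ∃ α β : Fin 3 → ℂ, ∀ i, S i = α i • T₀ + β i • T₁ := by
  rw [Fin.sum_univ_three] at h
  by_cases h0 : w 0 = 0
  · by_cases h1 : w 1 = 0
    · have h2 : w 2 ≠ 0 := by
        intro h2; apply hw; ext i; fin_cases i <;> simp [h0, h1, h2]
      refine ⟨S 0, S 1, ![1, 0, 0], ![0, 1, 0], fun i => ?_⟩
      have : S 2 = 0 := by simpa [h0, h1, h2] using h
      fin_cases i <;> simp [this]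
    · refine ⟨S 0, S 2, ![1, 0, 0], ![0, -((w 1)⁻¹ * w 2), 1], fun i => ?_⟩
      have : S 1 = -((w 1)⁻¹ * w 2) • S 2 := by
        have h3 : w 1 • S 1 = -(w 2 • S 2) := by
          rw [h0, zero_smul, zero_add] at h; exact eq_neg_of_add_eq_zero_left h
        rw [neg_smul, mul_smul, ← smul_neg, ← h3, smul_smul, inv_mul_cancel₀ h1, one_smul]
      fin_cases i
      · simp
      · simpa using this
      · simp
  · refine ⟨S 1, S 2, ![-((w 0)⁻¹ * w 1), 1, 0], ![-((w 0)⁻¹ * w 2), 0, 1], fun i => ?_⟩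
    have : S 0 = -((w 0)⁻¹ * w 1) • S 1 + -((w 0)⁻¹ * w 2) • S 2 := by
      have h3 : w 0 • S 0 = -(w 1 • S 1 + w 2 • S 2) := by
        rw [add_assoc] at h; exact eq_neg_of_add_eq_zero_left h
      have h4 : S 0 = (w 0)⁻¹ • (w 0 • S 0) := by
        rw [smul_smul, inv_mul_cancel₀ h0, one_smul]
      rw [h4, h3]; module
    fin_cases i
    · simpa using this
    · simp
    · simp

/-- If the operators on the second factor are linearly dependent, then diagonality on the first
factor implies diagonality on the second one. -/
lemma HasDiagonalBlocks.of_swap_of_dependent {R : Fin 3 → Matrix a a ℂ} {S : Fin 3 → Matrix b b ℂ}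
    (hU : kroneckerSum R S ∈ Matrix.unitaryGroup (a × b) ℂ) {w : Fin 3 → ℂ} (hw : w ≠ 0)
    (h : ∑ i, w i • S i = 0) (hd : HasDiagonalBlocks (kroneckerSum S R)) :
    HasDiagonalBlocks (kroneckerSum R S) := by
  obtain ⟨A, hA, B, hB, hd⟩ := hd
  have hU' := kroneckerSum_mul_mul_mem_unitaryGroup hU hA hB (one_mem _) (one_mem _)
  refine HasDiagonalBlocks.of_local hA hB (one_mem _) (one_mem _) ?_
  simp only [one_mul, mul_one] at hU' ⊢
  set R' : Fin 3 → Matrix a a ℂ := fun i => A * R i * B with hR'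
  have hoff : ∀ k l, k ≠ l → bipartiteBlock (kroneckerSum R' S) k l = 0 := by
    intro k l hkl
    ext p q
    have := hd p q hkl
    rw [bipartiteBlock_kroneckerSum, Finset.mul_sum, Finset.sum_mul, Matrix.sum_apply] at this
    rw [bipartiteBlock_kroneckerSum, Matrix.sum_apply, Matrix.zero_apply, ← this]
    refine Finset.sum_congr rfl fun i _ => ?_
    rw [Matrix.mul_smul, Matrix.smul_mul, Matrix.smul_apply, Matrix.smul_apply, smul_eq_mul,
      smul_eq_mul, mul_comm]
  -- With the off-diagonal blocks gone, the diagonal ones are unitaries in the span of the `S i`,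
  -- which dependence confines to the span of two matrices.
  have hV : ∀ k, bipartiteBlock (kroneckerSum R' S) k k ∈ Matrix.unitaryGroup b ℂ := by
    intro k
    rw [Matrix.mem_unitaryGroup_iff']
    have := sum_conjTranspose_bipartiteBlock_mul hU' k k
    rw [if_pos rfl, Finset.sum_eq_single k] at this
    · exact this
    · intro m _ hm
      rw [hoff m k hm, mul_zero]
    · simp
  obtain ⟨T₀, T₁, α, β, hT⟩ := exists_pair_of_sum_smul_eq_zero hw h
  obtain ⟨Q, hQ, W, hW, hdiag⟩ := exists_unitary_isDiag_of_mem_span_pair hV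
    (α := fun k => ∑ i, R' i k k * α i) (β := fun k => ∑ i, R' i k k * β i) (T₀ := T₀) (T₁ := T₁)
    (by
      intro k
      rw [bipartiteBlock_kroneckerSum, Finset.sum_smul, Finset.sum_smul, ← Finset.sum_add_distrib]
      refine Finset.sum_congr rfl fun i _ => ?_
      rw [hT i, smul_add, smul_smul, smul_smul])
  refine ⟨Q, hQ, W, hW, fun k l => ?_⟩
  by_cases hkl : k = l
  · subst hkl; exact hdiag k
  · rw [hoff k l hkl, mul_zero, zero_mul]; exact Matrix.isDiag_zero

/-- If the operators on the first factor are linearly independent, then diagonality of the blocks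
yields diagonality of each operator on the second factor. -/
lemma HasDiagonalBlocks.exists_forall_isDiag {R : Fin 3 → Matrix a a ℂ} {S : Fin 3 → Matrix b b ℂ}
    (hR : ∀ w : Fin 3 → ℂ, ∑ i, w i • R i = 0 → w = 0)
    (h : HasDiagonalBlocks (kroneckerSum R S)) :
    ∃ Q ∈ Matrix.unitaryGroup b ℂ, ∃ W ∈ Matrix.unitaryGroup b ℂ,
      ∀ i, (Q * S i * W).IsDiag := by
  obtain ⟨Q, hQ, W, hW, hd⟩ := h
  refine ⟨Q, hQ, W, hW, fun i x y hxy => ?_⟩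
  -- For fixed `x ≠ y`, the entries at `(x, y)` are the coefficients of a linear relation among the
  -- `R i`.
  refine congrFun (hR (fun i => (Q * S i * W) x y) ?_) i
  ext k l
  have := hd k l hxy
  rw [bipartiteBlock_kroneckerSum, Finset.mul_sum, Finset.sum_mul, Matrix.sum_apply] at this
  rw [Matrix.sum_apply, Matrix.zero_apply, ← this]
  refine Finset.sum_congr rfl fun i _ => ?_
  rw [Matrix.mul_smul, Matrix.smul_mul, Matrix.smul_apply, Matrix.smul_apply, smul_eq_mul,
    smul_eq_mul, mul_comm]

end Bipartite

/-! ### Splitting one factor and gluing the pieces. -/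

section Split

/-- The restriction of a unitary matrix to an invariant set of coordinates is unitary. -/
lemma submatrix_mem_unitaryGroup {m m' : Type*} [Fintype m] [DecidableEq m] [Fintype m']
    [DecidableEq m'] {U : Matrix m m ℂ} (hU : U ∈ Matrix.unitaryGroup m ℂ) {f : m' → m}
    (hf : Function.Injective f) (h : ∀ x ∉ Set.range f, ∀ y, U x (f y) = 0) :
    U.submatrix f f ∈ Matrix.unitaryGroup m' ℂ := by
  rw [Matrix.mem_unitaryGroup_iff'] at hU ⊢
  ext i j
  have h1 := congrFun (congrFun hU (f i)) (f j)
  rw [Matrix.mul_apply] at h1 ⊢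
  have h2 : (1 : Matrix m m ℂ) (f i) (f j) = (1 : Matrix m' m' ℂ) i j := by
    simp [Matrix.one_apply, hf.eq_iff]
  rw [← h2, ← h1]
  refine Fintype.sum_of_injective f hf _ _ (fun x hx => ?_) fun _ => rfl
  rw [h x hx, mul_zero]

variable {a : Type*} {b : Type*} [Fintype a] [DecidableEq a] [Fintype b] [DecidableEq b]

/-- In suitable orthonormal bases of the second factor, all blocks of `U` are block diagonal for a
common proper decomposition of the index set. -/
def IsBlockSplit (U : Matrix (a × b) (a × b) ℂ) : Prop :=
  ∃ s : Set b, s.Nonempty ∧ sᶜ.Nonempty ∧ BlocksVanish (fun p q => ¬(p ∈ s ↔ q ∈ s)) U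

lemma IsBlockSplit.of_local {ι : Type*} [Fintype ι] {R : ι → Matrix a a ℂ}
    {S : ι → Matrix b b ℂ} {A B : Matrix a a ℂ} {C D : Matrix b b ℂ}
    (hA : A ∈ Matrix.unitaryGroup a ℂ) (hB : B ∈ Matrix.unitaryGroup a ℂ)
    (hC : C ∈ Matrix.unitaryGroup b ℂ) (hD : D ∈ Matrix.unitaryGroup b ℂ)
    (h : IsBlockSplit (kroneckerSum (fun i => A * R i * B) (fun i => C * S i * D))) :
    IsBlockSplit (kroneckerSum R S) := by
  obtain ⟨s, h₁, h₂, h⟩ := h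
  exact ⟨s, h₁, h₂, BlocksVanish.of_local hA hB hC hD h⟩

lemma kroneckerSum_submatrix_mem_unitaryGroup {ι : Type*} [Fintype ι] {R : ι → Matrix a a ℂ}
    {S : ι → Matrix b b ℂ} (hU : kroneckerSum R S ∈ Matrix.unitaryGroup (a × b) ℂ) (s : Set b)
    [Fintype s] (h : ∀ k l, ∀ p ∉ s, ∀ q ∈ s, bipartiteBlock (kroneckerSum R S) k l p q = 0) :
    kroneckerSum R (fun i => (S i).submatrix ((↑) : s → b) (↑)) ∈
      Matrix.unitaryGroup (a × s) ℂ := by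
  have h1 : kroneckerSum R (fun i => (S i).submatrix ((↑) : s → b) (↑)) =
      (kroneckerSum R S).submatrix (Prod.map id (↑)) (Prod.map id (↑)) := by
    ext x y; simp [kroneckerSum_apply]
  rw [h1]
  refine submatrix_mem_unitaryGroup hU
    (Function.injective_id.prodMap Subtype.val_injective) ?_
  rintro ⟨k, p⟩ hx ⟨l, q⟩
  refine h k l p (fun hp => hx ⟨(k, ⟨p, hp⟩), rfl⟩) q q.2

/-- Unitarity of a block diagonal matrix. -/
lemma fromBlocks_reindex_mem_unitaryGroup {s t : Type*} [Fintype s] [Fintype t] [DecidableEq s]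
    [DecidableEq t] (e : s ⊕ t ≃ b) {Q₁ : Matrix s s ℂ} {Q₂ : Matrix t t ℂ}
    (h₁ : Q₁ ∈ Matrix.unitaryGroup s ℂ) (h₂ : Q₂ ∈ Matrix.unitaryGroup t ℂ) :
    (Matrix.fromBlocks Q₁ 0 0 Q₂).submatrix e.symm e.symm ∈ Matrix.unitaryGroup b ℂ := by
  rw [Matrix.mem_unitaryGroup_iff, Matrix.star_eq_conjTranspose] at *
  rw [Matrix.conjTranspose_submatrix, Matrix.submatrix_mul_equiv, Matrix.fromBlocks_conjTranspose,
    Matrix.fromBlocks_multiply]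
  simp [h₁, h₂]

/-- If the operators on the second factor are block diagonal, and both restrictions have diagonal
blocks, so has the whole operator. -/
lemma HasDiagonalBlocks.of_restrict {ι : Type*} [Fintype ι] {R : ι → Matrix a a ℂ}
    {S : ι → Matrix b b ℂ} (s : Set b) [Fintype s] [Fintype ↥sᶜ] [DecidablePred (· ∈ s)]
    (h : ∀ k l p q, ¬(p ∈ s ↔ q ∈ s) → bipartiteBlock (kroneckerSum R S) k l p q = 0)
    (h₁ : HasDiagonalBlocks (kroneckerSum R fun i => (S i).submatrix ((↑) : s → b) (↑)))
    (h₂ : HasDiagonalBlocks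
      (kroneckerSum R fun i => (S i).submatrix ((↑) : ↥sᶜ → b) (↑))) :
    HasDiagonalBlocks (kroneckerSum R S) := by
  obtain ⟨Q₁, hQ₁, W₁, hW₁, hd₁⟩ := h₁
  obtain ⟨Q₂, hQ₂, W₂, hW₂, hd₂⟩ := h₂
  let e : s ⊕ ↥sᶜ ≃ b := Equiv.Set.sumCompl s
  refine ⟨_, fromBlocks_reindex_mem_unitaryGroup e hQ₁ hQ₂, _,
    fromBlocks_reindex_mem_unitaryGroup e hW₁ hW₂, fun k l => ?_⟩
  have hb : bipartiteBlock (kroneckerSum R S) k l =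
      (Matrix.fromBlocks
        (bipartiteBlock (kroneckerSum R fun i => (S i).submatrix ((↑) : s → b) (↑)) k l) 0 0
        (bipartiteBlock (kroneckerSum R fun i => (S i).submatrix ((↑) : ↥sᶜ → b) (↑)) k l)).submatrix
        e.symm e.symm := by
    rw [← Matrix.submatrix_id_id (bipartiteBlock (kroneckerSum R S) k l)]
    have he : (id : b → b) = e ∘ e.symm := by ext x; simp
    rw [he, ← Matrix.submatrix_submatrix]
    congr 1
    ext (p | p) (q | q)
    · simp [bipartiteBlock, kroneckerSum_apply, e]
    · exact h k l p q (by simp [p.2]; exact q.2)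
    · exact h k l p q (by simp [q.2]; exact p.2)
    · simp [bipartiteBlock, kroneckerSum_apply, e]
  rw [hb, Matrix.submatrix_mul_equiv, Matrix.submatrix_mul_equiv, Matrix.fromBlocks_multiply,
    Matrix.fromBlocks_multiply]
  simp only [Matrix.mul_zero, Matrix.zero_mul, add_zero, zero_add]
  exact (Matrix.IsDiag.fromBlocks (hd₁ k l) (hd₂ k l)).submatrix e.symm.injective

/-- If a restriction to part of the second factor has its operators on the first factor diagonal,
but not those on the second, then the operators on the first factor are diagonal. -/
lemma hasDiagonalBlocks_of_submatrix {s : Type*} [Fintype s] [DecidableEq s] (f : s → b)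
    {R : Fin 3 → Matrix a a ℂ} {S : Fin 3 → Matrix b b ℂ}
    (hU : kroneckerSum R (fun i => (S i).submatrix f f) ∈ Matrix.unitaryGroup (a × s) ℂ)
    (h : HasDiagonalBlocks (kroneckerSum (fun i => (S i).submatrix f f) R))
    (hn : ¬HasDiagonalBlocks (kroneckerSum R fun i => (S i).submatrix f f)) :
    HasDiagonalBlocks (kroneckerSum S R) := by
  obtain ⟨Q, hQ, W, hW, hd⟩ := h.exists_forall_isDiag (by
    intro w hw
    by_contra hw0
    exact hn (HasDiagonalBlocks.of_swap_of_dependent hU hw0 hw h))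
  exact HasDiagonalBlocks.of_forall S hQ hW hd

/-- The pieces share the operators `R`. Either both are diagonal on the split factor and are glued,
or one of them is diagonal only on the other factor, which forces all `R i` to be diagonal in common
bases. The hypothesis `ih` ranges over types because the pieces live on the subtypes `s` and `sᶜ`.
-/
lemma IsBlockSplit.hasDiagonalBlocks {a b : Type} [Fintype a] [DecidableEq a] [Fintype b]
    [DecidableEq b] {R : Fin 3 → Matrix a a ℂ} {S : Fin 3 → Matrix b b ℂ}
    (hU : kroneckerSum R S ∈ Matrix.unitaryGroup (a × b) ℂ)
    (hs : IsBlockSplit (kroneckerSum R S))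
    (ih : ∀ (b' : Type) [Fintype b'] [DecidableEq b'], Fintype.card b' < Fintype.card b →
      ∀ S' : Fin 3 → Matrix b' b' ℂ, kroneckerSum R S' ∈ Matrix.unitaryGroup (a × b') ℂ →
        HasDiagonalBlocks (kroneckerSum S' R) ∨ HasDiagonalBlocks (kroneckerSum R S')) :
    HasDiagonalBlocks (kroneckerSum S R) ∨ HasDiagonalBlocks (kroneckerSum R S) := by
  classical
  obtain ⟨s, ⟨x, hx⟩, ⟨y, hy⟩, C, hC, D, hD, hsp⟩ := hs
  have hU' := kroneckerSum_mul_mul_mem_unitaryGroup hU (one_mem _) (one_mem _) hC hD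
  suffices H : HasDiagonalBlocks (kroneckerSum (fun i => C * S i * D) fun i => 1 * R i * 1) ∨
      HasDiagonalBlocks (kroneckerSum (fun i => 1 * R i * 1) fun i => C * S i * D) from
    H.imp (HasDiagonalBlocks.of_local hC hD (one_mem _) (one_mem _))
      (HasDiagonalBlocks.of_local (one_mem _) (one_mem _) hC hD)
  simp only [one_mul, mul_one] at hU' ⊢
  set S' : Fin 3 → Matrix b b ℂ := fun i => C * S i * D with hS'
  have hsp' : ∀ k l p q, ¬(p ∈ s ↔ q ∈ s) → bipartiteBlock (kroneckerSum R S') k l p q = 0 := by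
    intro k l p q hpq
    rw [← hsp k l p q hpq]
    simp only [bipartiteBlock_kroneckerSum, hS', Finset.mul_sum, Finset.sum_mul, Matrix.mul_smul,
      Matrix.smul_mul]
  have hU₁ := kroneckerSum_submatrix_mem_unitaryGroup hU' s
    (fun k l p hp q hq => hsp' k l p q (by tauto))
  have hU₂ := kroneckerSum_submatrix_mem_unitaryGroup hU' sᶜ
    (fun k l p hp q hq => hsp' k l p q (by simp only [Set.mem_compl_iff] at hp hq; tauto))
  have ih₁ := ih s (Fintype.card_subtype_lt (p := (· ∈ s)) hy) _ hU₁
  have ih₂ := ih ↥sᶜ (Fintype.card_subtype_lt (p := (· ∈ sᶜ)) (x := x) (by simpa using hx)) _ hU₂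
  by_cases h₁ : HasDiagonalBlocks (kroneckerSum R fun i => (S' i).submatrix ((↑) : s → b) (↑))
  · by_cases h₂ : HasDiagonalBlocks
        (kroneckerSum R fun i => (S' i).submatrix ((↑) : ↥sᶜ → b) (↑))
    · exact Or.inr (HasDiagonalBlocks.of_restrict s hsp' h₁ h₂)
    · exact Or.inl (hasDiagonalBlocks_of_submatrix _ hU₂ (ih₂.resolve_right h₂) h₂)
  · exact Or.inl (hasDiagonalBlocks_of_submatrix _ hU₁ (ih₁.resolve_right h₁) h₁)

end Split

/-! ### Kernel vectors, singular terms and Gram matrices. -/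

section Reduction

variable {a b : Type*} [Fintype a] [DecidableEq a] [Fintype b] [DecidableEq b]

lemma eq_zero_of_sum_mul_conjTranspose_eq_zero {ι : Type*} {s : Finset ι} {X : ι → Matrix a a ℂ}
    (h : ∑ q ∈ s, X q * (X q)ᴴ = 0) : ∀ q ∈ s, X q = 0 := by
  have h1 : ∑ q ∈ s, Matrix.trace (X q * (X q)ᴴ) = 0 := by
    rw [← Matrix.trace_sum, h, Matrix.trace_zero]
  rw [Finset.sum_eq_zero_iff_of_nonneg
    (fun q _ => (Matrix.posSemidef_self_mul_conjTranspose (X q)).trace_nonneg)] at h1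
  intro q hq
  exact Matrix.trace_mul_conjTranspose_self_eq_zero_iff.mp (h1 q hq)

/-- Every nonzero vector is, up to a scalar, a column of a unitary matrix. -/
lemma exists_unitary_mulVec_single (j : b) {v : b → ℂ} (hv : v ≠ 0) :
    ∃ D ∈ Matrix.unitaryGroup b ℂ, ∃ c : ℂ, c ≠ 0 ∧ D *ᵥ Pi.single j 1 = c • v := by
  set v' : EuclideanSpace ℂ b := WithLp.toLp 2 v with hv'
  have hv0 : v' ≠ 0 := by simpa [hv'] using hv
  have hn : (‖v'‖ : ℂ) ≠ 0 := by exact_mod_cast norm_ne_zero_iff.mpr hv0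
  have ho : Orthonormal ℂ (({j} : Set b).domRestrict fun _ => ((‖v'‖ : ℂ)⁻¹) • v') := by
    rw [orthonormal_iff_ite]
    rintro ⟨i, hi⟩ ⟨i', hi'⟩
    have : i = i' := hi.trans hi'.symm
    subst this
    simp only [Set.domRestrict_apply, if_true]
    rw [inner_self_eq_norm_sq_to_K, norm_smul, norm_inv, Complex.norm_real, norm_norm,
      inv_mul_cancel₀ (norm_ne_zero_iff.mpr hv0)]
    simp
  obtain ⟨e, he⟩ := ho.exists_orthonormalBasis_extension_of_card_eq (by simp)
  refine ⟨_, e.of_mem_unitaryGroup, (‖v'‖ : ℂ)⁻¹, inv_ne_zero hn, ?_⟩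
  ext p
  rw [Matrix.mulVec_single_one]
  simp [hv', he j rfl]

/-- If all operators on the second factor map a nonzero vector into a common line, that vector
splits off. -/
lemma hasDiagonalBlocks_or_isBlockSplit_of_mulVec {ι : Type*} [Fintype ι] {R : ι → Matrix a a ℂ}
    {S : ι → Matrix b b ℂ} (hU : kroneckerSum R S ∈ Matrix.unitaryGroup (a × b) ℂ) {v u : b → ℂ}
    (hv : v ≠ 0) {c : ι → ℂ} (h : ∀ i, S i *ᵥ v = c i • u) :
    HasDiagonalBlocks (kroneckerSum R S) ∨ IsBlockSplit (kroneckerSum R S) := by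
  obtain ⟨u', c', hu', h'⟩ : ∃ (u' : b → ℂ) (c' : ι → ℂ), u' ≠ 0 ∧ ∀ i, S i *ᵥ v = c' i • u' := by
    by_cases hu : u = 0
    · exact ⟨v, 0, hv, fun i => by rw [h i, hu]; simp⟩
    · exact ⟨u, c, hu, h⟩
  obtain ⟨j, -⟩ : ∃ j, v j ≠ 0 := Function.ne_iff.mp hv
  by_cases hb : ∃ j', j' ≠ j
  swap
  · left
    push Not at hb
    exact ⟨1, one_mem _, 1, one_mem _, fun k l p q hpq => absurd ((hb p).trans (hb q).symm) hpq⟩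
  right
  obtain ⟨D, hD, d, hd, hDv⟩ := exists_unitary_mulVec_single j hv
  obtain ⟨E, hE, e, he, hEu⟩ := exists_unitary_mulVec_single j hu'
  have hE' : Eᴴ * E = 1 := Matrix.mem_unitaryGroup_iff'.mp hE
  have hEH : Eᴴ ∈ Matrix.unitaryGroup b ℂ := Unitary.star_mem hE
  have hEu' : Eᴴ *ᵥ u' = e⁻¹ • Pi.single j 1 := by
    have : u' = e⁻¹ • (E *ᵥ Pi.single j 1) := by
      rw [hEu, smul_smul, inv_mul_cancel₀ he, one_smul]
    rw [this, Matrix.mulVec_smul, Matrix.mulVec_mulVec, hE', Matrix.one_mulVec]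
  have hU' := kroneckerSum_mul_mul_mem_unitaryGroup hU (one_mem _) (one_mem _) hEH hD
  refine IsBlockSplit.of_local (one_mem _) (one_mem _) hEH hD ?_
  simp only [one_mul, mul_one] at hU' ⊢
  set S' : ι → Matrix b b ℂ := fun i => Eᴴ * S i * D with hS'
  have hcol : ∀ i p, p ≠ j → S' i p j = 0 := by
    intro i p hp
    have h1 : S' i *ᵥ Pi.single j 1 = (d * c' i * e⁻¹) • Pi.single j 1 := by
      rw [hS', ← Matrix.mulVec_mulVec, hDv, Matrix.mulVec_smul, ← Matrix.mulVec_mulVec, h' i,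
        Matrix.mulVec_smul, hEu', smul_smul, smul_smul, mul_assoc]
    have h2 := congrFun h1 p
    rw [Matrix.mulVec_single_one] at h2
    simpa [hp] using h2
  have hW := swapFactors_mem_unitaryGroup hU'
  rw [swapFactors_kroneckerSum] at hW
  have hX0 : ∀ p, p ≠ j → bipartiteBlock (kroneckerSum S' R) p j = 0 := by
    intro p hp
    rw [bipartiteBlock_kroneckerSum]
    exact Finset.sum_eq_zero fun i _ => by rw [hcol i p hp, zero_smul]
  -- Column `j` has a single nonzero block, which is therefore unitary; it exhausts row `j`, so the
  -- other blocks of that row vanish.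
  have h1 := sum_conjTranspose_bipartiteBlock_mul hW j j
  rw [if_pos rfl, Finset.sum_eq_single j (fun m _ hm => by rw [hX0 m hm, mul_zero])
    (by simp)] at h1
  have h2 := mul_eq_one_comm.mp h1
  have h3 := sum_bipartiteBlock_mul_conjTranspose hW j j
  rw [if_pos rfl, ← Finset.add_sum_erase _ _ (Finset.mem_univ j), h2, add_eq_left] at h3
  have hX1 : ∀ q, q ≠ j → bipartiteBlock (kroneckerSum S' R) j q = 0 := fun q hq =>
    eq_zero_of_sum_mul_conjTranspose_eq_zero h3 q (by simp [hq])
  obtain ⟨j', hj'⟩ := hb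
  refine ⟨{j}, ⟨j, rfl⟩, ⟨j', hj'⟩, 1, one_mem _, 1, one_mem _, fun k l p q hpq => ?_⟩
  rw [one_mul, mul_one]
  have hsw : bipartiteBlock (kroneckerSum R S') k l p q =
      bipartiteBlock (kroneckerSum S' R) p q k l := by
    rw [← swapFactors_kroneckerSum S' R]; rfl
  rw [hsw]
  simp only [Set.mem_singleton_iff] at hpq
  by_cases hp : p = j
  · subst hp
    rw [hX1 q (by tauto), Matrix.zero_apply]
  · have hq : q = j := by tauto
    subst hq
    rw [hX0 p hp, Matrix.zero_apply]

lemma kroneckerSum_conjTranspose_mem {ι : Type*} [Fintype ι] {R : ι → Matrix a a ℂ}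
    {S : ι → Matrix b b ℂ} (hU : kroneckerSum R S ∈ Matrix.unitaryGroup (a × b) ℂ) :
    kroneckerSum (fun i => (R i)ᴴ) (fun i => (S i)ᴴ) ∈ Matrix.unitaryGroup (a × b) ℂ := by
  rw [← kroneckerSum_conjTranspose]
  exact Unitary.star_mem hU

/-- The adjoint form of `hasDiagonalBlocks_or_isBlockSplit_of_mulVec`. -/
lemma hasDiagonalBlocks_or_isBlockSplit_of_conjTranspose_mulVec {ι : Type*} [Fintype ι]
    {R : ι → Matrix a a ℂ} {S : ι → Matrix b b ℂ}
    (hU : kroneckerSum R S ∈ Matrix.unitaryGroup (a × b) ℂ) {v u : b → ℂ}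
    (hv : v ≠ 0) {c : ι → ℂ} (h : ∀ i, (S i)ᴴ *ᵥ v = c i • u) :
    HasDiagonalBlocks (kroneckerSum R S) ∨ IsBlockSplit (kroneckerSum R S) := by
  have := hasDiagonalBlocks_or_isBlockSplit_of_mulVec (kroneckerSum_conjTranspose_mem hU) hv h
  rw [← kroneckerSum_conjTranspose] at this
  refine this.imp (fun h => ?_) (fun h => ?_)
  · exact hasDiagonalBlocks_iff.mpr
      (BlocksVanish.of_conjTranspose (fun p q => Ne.symm) (hasDiagonalBlocks_iff.mp h))
  · obtain ⟨s, h₁, h₂, h⟩ := h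
    exact ⟨s, h₁, h₂, BlocksVanish.of_conjTranspose (fun p q => by tauto) h⟩

/-- Restriction of the relation `UᴴU = 1` to a unit vector of the first factor. -/
lemma sum_dotProduct_smul_eq_one {ι : Type*} [Fintype ι] {R : ι → Matrix a a ℂ}
    {S : ι → Matrix b b ℂ} (hU : kroneckerSum R S ∈ Matrix.unitaryGroup (a × b) ℂ) {y : a → ℂ}
    (hy : star y ⬝ᵥ y = 1) :
    ∑ i, ∑ j, (star (R i *ᵥ y) ⬝ᵥ (R j *ᵥ y)) • ((S i)ᴴ * S j) = 1 := by
  -- The compression of `UᴴU` to `y`, with `U` applied to `y` on the first factor only.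
  have h1 : ∑ k, (∑ l, y l • bipartiteBlock (kroneckerSum R S) k l)ᴴ *
      (∑ l, y l • bipartiteBlock (kroneckerSum R S) k l) = 1 := by
    calc _ = ∑ l, ∑ l', (star (y l) * y l') • ∑ k,
          (bipartiteBlock (kroneckerSum R S) k l)ᴴ * bipartiteBlock (kroneckerSum R S) k l' := by
          simp only [conjTranspose_sum, conjTranspose_smul, Finset.sum_mul, Finset.mul_sum,
            smul_mul_smul_comm, Finset.smul_sum]
          refine (Finset.sum_congr rfl fun k _ => Finset.sum_comm).trans ?_
          rw [Finset.sum_comm]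
          exact Finset.sum_congr rfl fun l _ => Finset.sum_comm
      _ = ∑ l, (star (y l) * y l) • (1 : Matrix b b ℂ) := by
          refine Finset.sum_congr rfl fun l _ => ?_
          simp only [sum_conjTranspose_bipartiteBlock_mul hU, smul_ite, smul_zero,
            Finset.sum_ite_eq, Finset.mem_univ, if_true]
      _ = 1 := by
          rw [← Finset.sum_smul]
          have : ∑ l, star (y l) * y l = 1 := hy
          rw [this, one_smul]
  have h2 : ∀ k, ∑ l, y l • bipartiteBlock (kroneckerSum R S) k l = ∑ i, (R i *ᵥ y) k • S i := by
    intro k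
    simp only [bipartiteBlock_kroneckerSum, Finset.smul_sum, smul_smul, Matrix.mulVec, dotProduct,
      Finset.sum_smul]
    rw [Finset.sum_comm]
    simp only [mul_comm]
  rw [← h1]
  simp only [h2, conjTranspose_sum, conjTranspose_smul, Finset.sum_mul, Finset.mul_sum,
    smul_mul_smul_comm, dotProduct, Finset.sum_smul, Pi.star_apply]
  rw [Finset.sum_comm (s := (Finset.univ : Finset a))]
  rw [Finset.sum_comm]
  refine Finset.sum_congr rfl fun i _ => ?_
  rw [Finset.sum_comm]

/-- A bipartite unitary `∑ i, R i ⊗ S i` can be rewritten with `R 0` singular. -/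
lemma exists_kroneckerSum_eq_det_eq_zero [Nonempty a] (R : Fin 3 → Matrix a a ℂ)
    (S : Fin 3 → Matrix b b ℂ) :
    ∃ (R' : Fin 3 → Matrix a a ℂ) (S' : Fin 3 → Matrix b b ℂ),
      kroneckerSum R' S' = kroneckerSum R S ∧ (R' 0).det = 0 := by
  by_cases h1 : (R 1).det = 0
  · refine ⟨fun i => R (Equiv.swap 0 1 i), fun i => S (Equiv.swap 0 1 i), ?_, by simpa using h1⟩
    exact Equiv.sum_comp (Equiv.swap (0 : Fin 3) 1) fun i => R i ⊗ₖ S i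
  -- With `μ` an eigenvalue of `R 0 * (R 1)⁻¹`, the matrix `R 0 - μ • R 1` is singular; adding `μ •
  -- S 0` to `S 1` compensates.
  · obtain ⟨μ, hμ⟩ := spectrum.nonempty_of_isAlgClosed_of_finiteDimensional ℂ (R 0 * (R 1)⁻¹)
    refine ⟨![R 0 - μ • R 1, R 1, R 2], ![S 0, S 1 + μ • S 0, S 2], ?_, ?_⟩
    · ext x y
      rw [kroneckerSum_apply, kroneckerSum_apply, Fin.sum_univ_three, Fin.sum_univ_three]
      change (R 0 - μ • R 1) x.1 y.1 * S 0 x.2 y.2 + R 1 x.1 y.1 * (S 1 + μ • S 0) x.2 y.2 +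
        R 2 x.1 y.1 * S 2 x.2 y.2 = _
      simp only [Matrix.sub_apply, Matrix.add_apply, Matrix.smul_apply, smul_eq_mul]
      ring
    · have h2 : (algebraMap ℂ (Matrix a a ℂ) μ - R 0 * (R 1)⁻¹).det = 0 := by
        by_contra h
        exact hμ ((Matrix.isUnit_iff_isUnit_det _).mpr (isUnit_iff_ne_zero.mpr h))
      have h3 : R 0 - μ • R 1 = -((algebraMap ℂ (Matrix a a ℂ) μ - R 0 * (R 1)⁻¹) * R 1) := by
        rw [sub_mul, mul_assoc, Matrix.nonsing_inv_mul _ (isUnit_iff_ne_zero.mpr h1), mul_one,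
          Algebra.algebraMap_eq_smul_one, smul_mul_assoc, one_mul, neg_sub]
      change (R 0 - μ • R 1).det = 0
      rw [h3, Matrix.det_neg, Matrix.det_mul, h2]; simp

lemma exists_unit_mulVec_eq_zero {M : Matrix a a ℂ} (h : M.det = 0) :
    ∃ y : a → ℂ, star y ⬝ᵥ y = 1 ∧ M *ᵥ y = 0 := by
  obtain ⟨v, hv, hMv⟩ := Matrix.exists_mulVec_eq_zero_iff.mpr h
  obtain ⟨j, -⟩ : ∃ j, v j ≠ 0 := Function.ne_iff.mp hv
  obtain ⟨D, hD, c, -, hDv⟩ := exists_unitary_mulVec_single j hv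
  have hD' : Dᴴ * D = 1 := Matrix.mem_unitaryGroup_iff'.mp hD
  refine ⟨D *ᵥ Pi.single j 1, ?_, by rw [hDv, Matrix.mulVec_smul, hMv, smul_zero]⟩
  rw [Matrix.star_mulVec, ← Matrix.dotProduct_mulVec, Matrix.mulVec_mulVec, hD', Matrix.one_mulVec]
  simp

/-- Either two vectors lie on a common line or their Gram matrix is positive definite. -/
lemma exists_line_or_posDef (x : Fin 2 → a → ℂ) :
    (∃ (z : a → ℂ) (c : Fin 2 → ℂ), ∀ i, x i = c i • z) ∨
      (Matrix.of fun i j => star (x i) ⬝ᵥ x j : Matrix (Fin 2) (Fin 2) ℂ).PosDef := by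
  by_cases h : Function.Injective (Matrix.of fun k i => x i k : Matrix a (Fin 2) ℂ).mulVec
  · right
    have h1 := Matrix.PosDef.conjTranspose_mul_self
      (Matrix.of fun k i => x i k : Matrix a (Fin 2) ℂ) h
    exact h1
  · left
    have h1 : ∃ w : Fin 2 → ℂ, w ≠ 0 ∧ w 0 • x 0 + w 1 • x 1 = 0 := by
      by_contra! hc
      apply h
      rw [← Matrix.coe_mulVecLin, ← LinearMap.ker_eq_bot, LinearMap.ker_eq_bot']
      intro w hw
      by_contra hw0
      apply hc w hw0
      ext k
      have := congrFun hw k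
      simpa [Matrix.mulVec, dotProduct, Fin.sum_univ_two, mul_comm] using this
    obtain ⟨w, hw, hw'⟩ := h1
    by_cases h0 : w 0 = 0
    · have h2 : w 1 ≠ 0 := by
        intro h2; apply hw; ext i; fin_cases i <;> simp [h0, h2]
      refine ⟨x 0, ![1, 0], fun i => ?_⟩
      have : x 1 = 0 := by simpa [h0, h2] using hw'
      fin_cases i <;> simp [this]
    · refine ⟨x 1, ![-((w 0)⁻¹ * w 1), 1], fun i => ?_⟩
      have : x 0 = -((w 0)⁻¹ * w 1) • x 1 := by
        have h3 := eq_neg_of_add_eq_zero_left hw'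
        rw [neg_smul, mul_smul, ← smul_neg, ← h3, smul_smul, inv_mul_cancel₀ h0, one_smul]
      fin_cases i
      · simpa using this
      · simp

end Reduction

/-! ### The reduction step and the induction. -/

section Main

variable {a b : Type*} [Fintype a] [DecidableEq a] [Fintype b] [DecidableEq b]

/-- The reduction step in a normal form: all operators on the second factor but the first are
diagonal, and the first operator on the first factor is diagonal, nonzero and singular. -/
lemma isBlockSplit_of_diagonal {R : Fin 3 → Matrix a a ℂ} {S : Fin 3 → Matrix b b ℂ}
    (hU : kroneckerSum R S ∈ Matrix.unitaryGroup (a × b) ℂ) (hS : ∀ i : Fin 2, (S i.succ).IsDiag)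
    {r : a → ℂ} (hR : R 0 = Matrix.diagonal r) {k₀ k₁ : a} (h₀ : r k₀ = 0) (h₁ : r k₁ ≠ 0) :
    HasDiagonalBlocks (kroneckerSum R S) ∨ IsBlockSplit (kroneckerSum S R) ∨
      IsBlockSplit (kroneckerSum R S) := by
  have hW := swapFactors_mem_unitaryGroup hU
  rw [swapFactors_kroneckerSum] at hW
  set X : b → b → Matrix a a ℂ := fun p q => bipartiteBlock (kroneckerSum S R) p q with hX
  have hoff : ∀ p q, p ≠ q → X p q = S 0 p q • R 0 := by
    intro p q hpq
    simp only [hX]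
    rw [bipartiteBlock_kroneckerSum, Fin.sum_univ_succ,
      Finset.sum_eq_zero fun i _ => by rw [hS i hpq, zero_smul], add_zero]
  set N : Matrix a a ℂ := Matrix.diagonal fun k => r k * star (r k) with hN
  have hRR : R 0 * (R 0)ᴴ = N := by
    rw [hR, Matrix.diagonal_conjTranspose, Matrix.diagonal_mul_diagonal]; rfl
  have hRR' : (R 0)ᴴ * R 0 = N := by
    rw [hR, Matrix.diagonal_conjTranspose, Matrix.diagonal_mul_diagonal]
    simp only [hN, Pi.star_apply, mul_comm]
  have hR0 : R 0 ≠ 0 := by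
    intro h
    apply h₁
    have := congrFun (congrFun (hR.symm.trans h) k₁) k₁
    simpa using this
  have htr : Matrix.trace N ≠ 0 := by
    rw [← hRR]
    exact fun h => hR0 (Matrix.trace_mul_conjTranspose_self_eq_zero_iff.mp h)
  -- The squared norms of the off-diagonal parts of row and column `p` of `S 0`; they are the
  -- amounts of `N` missing from `X p p * (X p p)ᴴ` and `(X p p)ᴴ * X p p`, and traces show them
  -- equal.
  set ρ : b → ℂ := fun p => ∑ m ∈ Finset.univ.erase p, S 0 p m * star (S 0 p m) with hρ
  set σ : b → ℂ := fun p => ∑ m ∈ Finset.univ.erase p, S 0 m p * star (S 0 m p) with hσ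
  have hrow : ∀ p, X p p * (X p p)ᴴ = 1 - ρ p • N := by
    intro p
    have h := sum_bipartiteBlock_mul_conjTranspose hW p p
    rw [if_pos rfl, ← Finset.add_sum_erase _ _ (Finset.mem_univ p)] at h
    rw [eq_sub_iff_add_eq, ← h, hρ, Finset.sum_smul]
    congr 1
    refine Finset.sum_congr rfl fun m hm => ?_
    change _ = X p m * (X p m)ᴴ
    rw [hoff p m (Finset.ne_of_mem_erase hm).symm, conjTranspose_smul, smul_mul_smul_comm, hRR]
  have hcol : ∀ p, (X p p)ᴴ * X p p = 1 - σ p • N := by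
    intro p
    have h := sum_conjTranspose_bipartiteBlock_mul hW p p
    rw [if_pos rfl, ← Finset.add_sum_erase _ _ (Finset.mem_univ p)] at h
    rw [eq_sub_iff_add_eq, ← h, hσ, Finset.sum_smul]
    congr 1
    refine Finset.sum_congr rfl fun m hm => ?_
    change _ = (X m p)ᴴ * X m p
    rw [hoff m p (Finset.ne_of_mem_erase hm), conjTranspose_smul, smul_mul_smul_comm, hRR',
      mul_comm]
  have hρσ : ∀ p, ρ p = σ p := by
    intro p
    have h := Matrix.trace_mul_comm (X p p) (X p p)ᴴ
    rw [hrow, hcol, Matrix.trace_sub, Matrix.trace_sub, Matrix.trace_smul, Matrix.trace_smul,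
      sub_right_inj] at h
    exact mul_right_cancel₀ htr h
  have hzero : ∀ (x : b → ℂ) (p : b), ∑ m ∈ Finset.univ.erase p, x m * star (x m) = 0 →
      ∀ m, m ≠ p → x m = 0 := by
    intro x p h m hm
    rw [Finset.sum_eq_zero_iff_of_nonneg (fun m _ => mul_star_self_nonneg (x m))] at h
    have := h m (by simp [hm])
    simpa using this
  by_cases hex : ∃ p, ρ p = 0
  -- Row and column `p` of `S 0` vanish off the diagonal, so the coordinate `p` splits off.
  · obtain ⟨p, hp⟩ := hex
    have hp' : σ p = 0 := by rw [← hρσ p, hp]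
    have hp1 := hzero (fun m => S 0 p m) p hp
    have hp2 := hzero (fun m => S 0 m p) p hp'
    by_cases hb : ∃ p', p' ≠ p
    · right; right
      obtain ⟨p', hp'⟩ := hb
      refine ⟨{p}, ⟨p, rfl⟩, ⟨p', hp'⟩, 1, one_mem _, 1, one_mem _, fun k l x y hxy => ?_⟩
      simp only [Set.mem_singleton_iff] at hxy
      have hne : x ≠ y := by rintro rfl; exact hxy Iff.rfl
      have h0 : S 0 x y = 0 := by
        by_cases hx : x = p
        · subst hx; exact hp1 y hne.symm
        · have hy : y = p := by tauto
          subst hy; exact hp2 x hx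
      rw [one_mul, mul_one, bipartiteBlock_kroneckerSum, Matrix.sum_apply, Fin.sum_univ_succ]
      simp only [Matrix.smul_apply]
      rw [h0, smul_zero, zero_add]
      exact Finset.sum_eq_zero fun i _ => by rw [hS i hne, smul_zero]
    · left
      push Not at hb
      exact ⟨1, one_mem _, 1, one_mem _, fun k l x y hxy => absurd ((hb x).trans (hb y).symm) hxy⟩
  · push Not at hex
    right; left
    -- As no `ρ p` vanishes, every diagonal block commutes with `N`, so the kernel of `R 0` and its
    -- complement are not mixed; the other blocks are multiples of the diagonal `R 0`.
    refine ⟨{k | r k = 0}, ⟨k₀, h₀⟩, ⟨k₁, h₁⟩, 1, one_mem _, 1, one_mem _, fun p q k l hkl => ?_⟩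
    rw [one_mul, mul_one]
    change X p q k l = 0
    simp only [Set.mem_ofPred_eq] at hkl
    by_cases hpq : p = q
    · subst hpq
      have hc : N * X p p = X p p * N := by
        have h1 : (X p p * (X p p)ᴴ) * X p p = X p p * ((X p p)ᴴ * X p p) := mul_assoc _ _ _
        rw [hrow, hcol, ← hρσ p, sub_mul, mul_sub, one_mul, mul_one, sub_right_inj,
          Matrix.smul_mul, Matrix.mul_smul] at h1
        exact smul_right_injective _ (hex p) h1
      have h2 := congrFun (congrFun hc k) l
      rw [hN, Matrix.diagonal_mul, Matrix.mul_diagonal] at h2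
      by_contra hne
      apply hkl
      rw [mul_comm] at h2
      have h3 := mul_left_cancel₀ hne h2
      constructor
      · intro h; rw [h, zero_mul] at h3; simpa using h3.symm
      · intro h; rw [h, zero_mul] at h3; simpa using h3
    · have hne : k ≠ l := by rintro rfl; exact hkl Iff.rfl
      rw [hoff p q hpq, Matrix.smul_apply, hR, Matrix.diagonal_apply_ne _ hne, smul_zero]

/-- The reduction step: an operator of Schmidt rank at most three is diagonal on one factor or
decomposes properly on one factor. -/
lemma hasDiagonalBlocks_or_isBlockSplit [Nonempty a] {R : Fin 3 → Matrix a a ℂ}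
    {S : Fin 3 → Matrix b b ℂ} (hU : kroneckerSum R S ∈ Matrix.unitaryGroup (a × b) ℂ) :
    (HasDiagonalBlocks (kroneckerSum S R) ∨ HasDiagonalBlocks (kroneckerSum R S)) ∨
      (IsBlockSplit (kroneckerSum S R) ∨ IsBlockSplit (kroneckerSum R S)) := by
  obtain ⟨R', S', hRS, hdet⟩ := exists_kroneckerSum_eq_det_eq_zero R S
  have hSR : kroneckerSum S' R' = kroneckerSum S R := by
    rw [← swapFactors_kroneckerSum, hRS, swapFactors_kroneckerSum]
  rw [← hRS, ← hSR]
  rw [← hRS] at hU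
  clear hRS hSR R S
  have hW := swapFactors_mem_unitaryGroup hU
  rw [swapFactors_kroneckerSum] at hW
  obtain ⟨y, hy, hy0⟩ := exists_unit_mulVec_eq_zero hdet
  obtain ⟨x, hx, hx0⟩ := exists_unit_mulVec_eq_zero
    (M := (R' 0)ᴴ) (by rw [Matrix.det_conjTranspose, hdet, star_zero])
  have hne : ∀ {v : a → ℂ}, star v ⬝ᵥ v = 1 → v ≠ 0 := by
    rintro v hv rfl; simp at hv
  have hpack : ∀ {M : Fin 3 → Matrix a a ℂ} {v z : a → ℂ} {c : Fin 2 → ℂ}, M 0 *ᵥ v = 0 →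
      (∀ i : Fin 2, M i.succ *ᵥ v = c i • z) →
        ∀ i, M i *ᵥ v = (Fin.cons 0 c : Fin 3 → ℂ) i • z := by
    intro M v z c h0 h i
    refine Fin.cases ?_ (fun j => ?_) i
    · rw [h0, Fin.cons_zero, zero_smul]
    · rw [h j, Fin.cons_succ]
  rcases exists_line_or_posDef (fun i : Fin 2 => R' i.succ *ᵥ y) with ⟨z, c, hz⟩ | hpd
  · rcases hasDiagonalBlocks_or_isBlockSplit_of_mulVec hW (hne hy) (hpack hy0 hz) with h | h
    · exact Or.inl (Or.inl h)
    · exact Or.inr (Or.inl h)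
  rcases exists_line_or_posDef (fun i : Fin 2 => (R' i.succ)ᴴ *ᵥ x) with ⟨z, c, hz⟩ | hpd'
  · rcases hasDiagonalBlocks_or_isBlockSplit_of_conjTranspose_mulVec hW (hne hx)
      (hpack (M := fun i => (R' i)ᴴ) hx0 hz) with h | h
    · exact Or.inl (Or.inl h)
    · exact Or.inr (Or.inl h)
  have e1 := sum_dotProduct_smul_eq_one hU hy
  have e2 := sum_dotProduct_smul_eq_one (kroneckerSum_conjTranspose_mem hU) hx
  simp only [conjTranspose_conjTranspose] at e2
  simp only [Fin.sum_univ_succ (n := 2), hy0, hx0, star_zero, zero_dotProduct, dotProduct_zero,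
    zero_smul, Finset.sum_const_zero, zero_add] at e1 e2
  -- The relation from `UUᴴ` has the products `S i * (S j)ᴴ` in the opposite index order, hence the
  -- transposed Gram matrix.
  obtain ⟨C, hC, D, hD, hdiag⟩ := exists_unitary_isDiag_of_posDef hpd hpd'.transpose
    (S := fun i => S' i.succ) e1 (by rw [Finset.sum_comm]; exact e2)
  by_cases hR0 : R' 0 = 0
  · left; right
    refine ⟨C, hC, D, hD, fun k l => ?_⟩
    rw [bipartiteBlock_kroneckerSum, Fin.sum_univ_succ, hR0, Matrix.zero_apply, zero_smul,
      zero_add, Finset.mul_sum, Finset.sum_mul]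
    refine isDiag_sum _ fun i => ?_
    rw [Matrix.mul_smul, Matrix.smul_mul]
    exact (hdiag i).smul _
  obtain ⟨A, hA, B, hB, t, -, ht⟩ := exists_unitary_mul_mul_eq_diagonal (R' 0)
  have hdet' : (Matrix.diagonal fun i => (t i : ℂ)).det = 0 := by
    rw [← ht, Matrix.det_mul, Matrix.det_mul, hdet, mul_zero, zero_mul]
  rw [Matrix.det_diagonal, Finset.prod_eq_zero_iff] at hdet'
  obtain ⟨k₀, -, hk₀⟩ := hdet'
  obtain ⟨k₁, hk₁⟩ : ∃ k₁, (t k₁ : ℂ) ≠ 0 := by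
    by_contra! hall
    apply hR0
    have hA' : Aᴴ * A = 1 := Matrix.mem_unitaryGroup_iff'.mp hA
    have hB' : B * Bᴴ = 1 := Matrix.mem_unitaryGroup_iff.mp hB
    have h1 : A * R' 0 * B = 0 := by rw [ht]; ext i j; simp [Matrix.diagonal_apply, hall]
    calc R' 0 = Aᴴ * (A * R' 0 * B) * Bᴴ := by
          rw [mul_assoc A, ← mul_assoc Aᴴ, hA', one_mul, mul_assoc, hB', mul_one]
      _ = 0 := by rw [h1, mul_zero, zero_mul]
  rcases isBlockSplit_of_diagonal (kroneckerSum_mul_mul_mem_unitaryGroup hU hA hB hC hD) hdiag ht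
    hk₀ hk₁ with h | h | h
  · exact Or.inl (Or.inr (h.of_local hA hB hC hD))
  · exact Or.inr (Or.inl (h.of_local hC hD hA hB))
  · exact Or.inr (Or.inr (h.of_local hA hB hC hD))

/-- A bipartite unitary operator `∑ i, R i ⊗ S i` with three terms is diagonal on one of the
factors. -/
theorem hasDiagonalBlocks_or_hasDiagonalBlocks {a b : Type} [Fintype a] [DecidableEq a]
    [Fintype b] [DecidableEq b] (R : Fin 3 → Matrix a a ℂ) (S : Fin 3 → Matrix b b ℂ)
    (hU : kroneckerSum R S ∈ Matrix.unitaryGroup (a × b) ℂ) :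
    HasDiagonalBlocks (kroneckerSum S R) ∨ HasDiagonalBlocks (kroneckerSum R S) := by
  -- The sum of the cardinalities serves because a split may shrink either factor.
  induction hn : Fintype.card a + Fintype.card b using Nat.strong_induction_on
    generalizing a b with
  | _ n ih =>
    rcases isEmpty_or_nonempty a with ha | ha
    · exact Or.inr ⟨1, one_mem _, 1, one_mem _, fun k => ha.elim k⟩
    rcases hasDiagonalBlocks_or_isBlockSplit hU with h | h | h
    · exact h
    · have hW := swapFactors_mem_unitaryGroup hU
      rw [swapFactors_kroneckerSum] at hW
      refine (h.hasDiagonalBlocks hW fun a' _ _ ha' R' hR' => ?_).symm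
      exact ih _ (by omega) S R' hR' (add_comm _ _)
    · refine h.hasDiagonalBlocks hU fun b' _ _ hb' S' hS' => ?_
      exact ih _ (by omega) R S' hS' rfl

end Main

/-! ### Controlled form and partial transposition. -/

section Controlled

variable {a b : Type*} [Fintype a] [DecidableEq a] [Fintype b] [DecidableEq b]

/-- Normal form of an operator with diagonal blocks. -/
lemma HasDiagonalBlocks.exists_eq_sum_single {ι : Type*} [Fintype ι] {R : ι → Matrix a a ℂ}
    {S : ι → Matrix b b ℂ} (hU : kroneckerSum R S ∈ Matrix.unitaryGroup (a × b) ℂ)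
    (h : HasDiagonalBlocks (kroneckerSum R S)) :
    ∃ Q ∈ Matrix.unitaryGroup b ℂ, ∃ W ∈ Matrix.unitaryGroup b ℂ, ∃ V : b → Matrix a a ℂ,
      (∀ p, V p ∈ Matrix.unitaryGroup a ℂ) ∧
        kroneckerSum R (fun i => Q * S i * W) = ∑ p, V p ⊗ₖ Matrix.single p p (1 : ℂ) := by
  obtain ⟨Q, hQ, W, hW, hd⟩ := h
  have hU' := kroneckerSum_mul_mul_mem_unitaryGroup hU (one_mem _) (one_mem _) hQ hW
  simp only [one_mul, mul_one] at hU'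
  have hsw := swapFactors_mem_unitaryGroup hU'
  rw [swapFactors_kroneckerSum] at hsw
  have hoff : ∀ p q, p ≠ q → bipartiteBlock (kroneckerSum (fun i => Q * S i * W) R) p q = 0 := by
    intro p q hpq
    ext k l
    have := hd k l hpq
    rw [bipartiteBlock_kroneckerSum, Finset.mul_sum, Finset.sum_mul, Matrix.sum_apply] at this
    rw [bipartiteBlock_kroneckerSum, Matrix.sum_apply, Matrix.zero_apply, ← this]
    refine Finset.sum_congr rfl fun i _ => ?_
    rw [Matrix.mul_smul, Matrix.smul_mul, Matrix.smul_apply, Matrix.smul_apply, smul_eq_mul,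
      smul_eq_mul, mul_comm]
  refine ⟨Q, hQ, W, hW, fun p => bipartiteBlock (kroneckerSum (fun i => Q * S i * W) R) p p,
    fun p => ?_, ?_⟩
  · rw [Matrix.mem_unitaryGroup_iff']
    have := sum_conjTranspose_bipartiteBlock_mul hsw p p
    rw [if_pos rfl, Finset.sum_eq_single p (fun m _ hm => by rw [hoff m p hm, mul_zero])
      (by simp)] at this
    exact this
  · ext ⟨k, p⟩ ⟨l, q⟩
    have h1 : kroneckerSum R (fun i => Q * S i * W) (k, p) (l, q) =
        bipartiteBlock (kroneckerSum (fun i => Q * S i * W) R) p q k l := by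
      rw [← swapFactors_kroneckerSum]; rfl
    rw [h1, Matrix.sum_apply]
    simp only [Matrix.kroneckerMap_apply, Matrix.single_apply]
    by_cases hpq : p = q
    · subst hpq
      rw [Finset.sum_eq_single p (fun m _ hm => by simp [hm]) (by simp)]
      simp
    · rw [hoff p q hpq, Matrix.zero_apply, eq_comm]
      refine Finset.sum_eq_zero fun m _ => ?_
      rw [if_neg (by rintro ⟨rfl, rfl⟩; exact hpq rfl), mul_zero]

lemma transpose_mem_unitaryGroup {A : Matrix a a ℂ} (hA : A ∈ Matrix.unitaryGroup a ℂ) :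
    Aᵀ ∈ Matrix.unitaryGroup a ℂ := by
  have h₁ : Aᴴ * A = 1 := Matrix.mem_unitaryGroup_iff'.mp hA
  have h₂ : star Aᵀ = (Aᴴ)ᵀ := rfl
  rw [Matrix.mem_unitaryGroup_iff, h₂, ← Matrix.transpose_mul, h₁, Matrix.transpose_one]

/-- The partial transpose of a unitary operator with diagonal blocks is unitary. -/
lemma HasDiagonalBlocks.partialTranspose_mem_unitaryGroup {ι : Type*} [Fintype ι]
    {R : ι → Matrix a a ℂ} {S : ι → Matrix b b ℂ}
    (hU : kroneckerSum R S ∈ Matrix.unitaryGroup (a × b) ℂ)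
    (h : HasDiagonalBlocks (kroneckerSum R S)) :
    kroneckerSum R (fun i => (S i)ᵀ) ∈ Matrix.unitaryGroup (a × b) ℂ := by
  obtain ⟨Q, hQ, W, hW, V, hV, hsum⟩ := h.exists_eq_sum_single hU
  have hU' := kroneckerSum_mul_mul_mem_unitaryGroup hU (one_mem _) (one_mem _) hQ hW
  simp only [one_mul, mul_one] at hU'
  -- Each `|p⟩⟨p|` is symmetric, so the normal form is its own partial transpose. What remains is to
  -- remove the transposed local unitaries.
  have hsymm : kroneckerSum R (fun i => (Q * S i * W)ᵀ) = kroneckerSum R fun i => Q * S i * W := by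
    ext ⟨k, p⟩ ⟨l, q⟩
    have h1 : kroneckerSum R (fun i => (Q * S i * W)ᵀ) (k, p) (l, q) =
        kroneckerSum R (fun i => Q * S i * W) (k, q) (l, p) := by
      simp only [kroneckerSum_apply, Matrix.transpose_apply]
    rw [h1, hsum, Matrix.sum_apply, Matrix.sum_apply]
    refine Finset.sum_congr rfl fun m _ => ?_
    simp only [Matrix.kroneckerMap_apply, Matrix.single_apply, and_comm]
  rw [← hsymm] at hU'
  have hQT := transpose_mem_unitaryGroup hQ
  have hWT := transpose_mem_unitaryGroup hW
  have h2 := kroneckerSum_mul_mul_mem_unitaryGroup hU' (one_mem _) (one_mem _)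
    (Unitary.star_mem hWT) (Unitary.star_mem hQT)
  have hQ2 : Qᵀ * star Qᵀ = 1 := Matrix.mem_unitaryGroup_iff.mp hQT
  have hW2 : star Wᵀ * Wᵀ = 1 := Matrix.mem_unitaryGroup_iff'.mp hWT
  have h3 : ∀ i, star Wᵀ * (Q * S i * W)ᵀ * star Qᵀ = (S i)ᵀ := by
    intro i
    calc star Wᵀ * (Q * S i * W)ᵀ * star Qᵀ = (star Wᵀ * Wᵀ) * (S i)ᵀ * (Qᵀ * star Qᵀ) := by
          simp only [Matrix.transpose_mul, mul_assoc]
      _ = (S i)ᵀ := by rw [hQ2, hW2, one_mul, mul_one]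
  simpa only [h3, one_mul, mul_one] using h2

/-- The partial transpose on the second factor is the full transpose of the one on the first, and
full transposition preserves unitarity. -/
lemma partialTranspose_mem_unitaryGroup_of_swap {ι : Type*} [Fintype ι]
    {R : ι → Matrix a a ℂ} {S : ι → Matrix b b ℂ}
    (hU : kroneckerSum R S ∈ Matrix.unitaryGroup (a × b) ℂ)
    (h : HasDiagonalBlocks (kroneckerSum S R)) :
    kroneckerSum R (fun i => (S i)ᵀ) ∈ Matrix.unitaryGroup (a × b) ℂ := by
  have hW := swapFactors_mem_unitaryGroup hU
  rw [swapFactors_kroneckerSum] at hW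
  have h1 := swapFactors_mem_unitaryGroup (h.partialTranspose_mem_unitaryGroup hW)
  rw [swapFactors_kroneckerSum] at h1
  have h2 := transpose_mem_unitaryGroup h1
  have h3 : (kroneckerSum (fun i => (R i)ᵀ) S)ᵀ = kroneckerSum R fun i => (S i)ᵀ := by
    ext x y
    simp only [kroneckerSum_apply, Matrix.transpose_apply]
  rwa [h3] at h2

lemma isControlledFromB_of_hasDiagonalBlocks {dA dB : ℕ} {ι : Type*} [Fintype ι]
    {R : ι → Matrix (Fin dA) (Fin dA) ℂ} {S : ι → Matrix (Fin dB) (Fin dB) ℂ}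
    (hU : kroneckerSum R S ∈ Matrix.unitaryGroup (Fin dA × Fin dB) ℂ)
    (h : HasDiagonalBlocks (kroneckerSum R S)) : IsControlledFromB (kroneckerSum R S) := by
  obtain ⟨Q, hQ, W, hW, V, hV, hsum⟩ := h.exists_eq_sum_single hU
  have hQ2 : star Q * Q = 1 := Matrix.mem_unitaryGroup_iff'.mp hQ
  have hW2 : W * star W = 1 := Matrix.mem_unitaryGroup_iff.mp hW
  refine ⟨V, hV, 1, one_mem _, star Q, Unitary.star_mem hQ, 1, one_mem _, star W,
    Unitary.star_mem hW, ?_⟩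
  rw [← hsum, ← kroneckerSum_mul_mul]
  congr 1
  · ext i; simp
  · ext1 i
    rw [mul_assoc Q, ← mul_assoc (star Q), hQ2, one_mul, mul_assoc, hW2, mul_one]

lemma isControlledFromA_of_hasDiagonalBlocks {dA dB : ℕ} {ι : Type*} [Fintype ι]
    {R : ι → Matrix (Fin dA) (Fin dA) ℂ} {S : ι → Matrix (Fin dB) (Fin dB) ℂ}
    (hU : kroneckerSum R S ∈ Matrix.unitaryGroup (Fin dA × Fin dB) ℂ)
    (h : HasDiagonalBlocks (kroneckerSum S R)) : IsControlledFromA (kroneckerSum R S) := by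
  have hsw := swapFactors_mem_unitaryGroup hU
  rw [swapFactors_kroneckerSum] at hsw
  obtain ⟨V, hV, Q', hQ', Q, hQ, W', hW', W, hW, e⟩ := isControlledFromB_of_hasDiagonalBlocks hsw h
  refine ⟨V, hV, Q, hQ, Q', hQ', W, hW, W', hW', ?_⟩
  have e1 : ∑ k, V k ⊗ₖ Matrix.single k k (1 : ℂ) =
      kroneckerSum V fun k => Matrix.single k k (1 : ℂ) := rfl
  have e2 : ∑ k, Matrix.single k k (1 : ℂ) ⊗ₖ V k =
      kroneckerSum (fun k => Matrix.single k k (1 : ℂ)) V := rfl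
  rw [e1, ← kroneckerSum_mul_mul] at e
  rw [e2, ← kroneckerSum_mul_mul, ← swapFactors_kroneckerSum, e, swapFactors_kroneckerSum]

end Controlled

theorem mainTheorem6 (dA dB : ℕ) (hA : dA ≤ 3)
    (R : Fin 3 → Matrix (Fin dA) (Fin dA) ℂ) (S : Fin 3 → Matrix (Fin dB) (Fin dB) ℂ)
    (hU : (∑ i, R i ⊗ₖ S i) ∈ Matrix.unitaryGroup (Fin dA × Fin dB) ℂ) :
    IsControlledUnitary (∑ i, R i ⊗ₖ S i) ∧
    (∑ i, R i ⊗ₖ (S i).transpose).rank = (∑ i, R i ⊗ₖ S i).rank ∧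
    (∑ i, R i ⊗ₖ (S i).transpose).rank ≤ 3 * (∑ i, R i ⊗ₖ S i).rank := by
  have hd := hasDiagonalBlocks_or_hasDiagonalBlocks R S hU
  have hΓ : (∑ i, R i ⊗ₖ (S i).transpose) ∈ Matrix.unitaryGroup (Fin dA × Fin dB) ℂ :=
    hd.elim (partialTranspose_mem_unitaryGroup_of_swap hU)
      (HasDiagonalBlocks.partialTranspose_mem_unitaryGroup hU)
  have hrank : ∀ {M : Matrix (Fin dA × Fin dB) (Fin dA × Fin dB) ℂ},
      M ∈ Matrix.unitaryGroup (Fin dA × Fin dB) ℂ → M.rank = Fintype.card (Fin dA × Fin dB) :=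
    fun hM => Matrix.rank_of_isUnit _
      (IsUnit.of_mul_eq_one _ (Matrix.mem_unitaryGroup_iff.mp hM))
  refine ⟨hd.imp (isControlledFromA_of_hasDiagonalBlocks hU)
    (isControlledFromB_of_hasDiagonalBlocks hU), ?_, ?_⟩
  · rw [hrank hΓ, hrank hU]
  · rw [hrank hΓ, hrank hU]; omega
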